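/- A tournament is a finite directed graph in which, for any two distinct vertices $v,w$, exactly one of $(v,w)$, $(w,v)$ is an edge; $|H|$ is the number of vertices of $H$. It is transitive if it has no directed cycle. A tournament is $H$-free if it does not contain $H$ as an induced subtournament. The Erdős–Hajnal coefficient $\epsilon(H)$ is the supremum of all $e>0$ such that every $H$-free tournament $T$ contains a transitive subtournament with at least $|T|^{e}$ vertices. A set $S\subseteq V(H)$ is homogeneous if every vertex outside $S$ is either adjacent to all of $S$ or adjacent from all of $S$; $H$ is prime if it has no homogeneous set $S$ with $|S|>1$ and $S\neq V(H)$. For an ordering $\theta$ of $V(H)$, the graph of backward edges is the undirected graph on $V(H)$ in which $v,w$ are joined if $v$ precedes $w$ in $\theta$ and $(w,v)$ is an edge of $H$. The tournament $H$ is a galaxy if it has an ordering $\theta$ such that (i) every connected component of the graph of backward edges is a single vertex or a star $K_{1,t}$ ($t\ge 1$) whose center precedes all its leaves or succeeds all its leaves in $\theta$, and (ii) no center of a star lies, in $\theta$, between two leaves of another star (if $t=1$, either vertex may be chosen as the center). Theorem. There are functions $f,g:\mathbb{N}\to\mathbb{R}$ with $f(n)\to 0$ and $g(n)\to 0$ as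 $n\to\infty$ such that every prime galaxy $H$ with $|H|\ge 3$ satisfies $0<\epsilon(H)<\infty$ and $$-5+f(|H|)\;\le\;\frac{\log \epsilon(H)}{\log |H|}\;\le\;-1+g(|H|).$$ That is, every prime galaxy $H$ satisfies $-5+o(1)\le \log\epsilon(H)/\log|H|\le -1+o(1)$, where the $o(1)$ terms tend to $0$ as $|H|\to\infty$, uniformly over prime galaxies. -/

import Mathlib

open Filter Topology

/-- A tournament on `V`: a digraph in which, for every two distinct vertices `v`, `w`, exactly one
of `(v, w)`, `(w, v)` is an edge (and there are no loops). -/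
structure Tournament (V : Type*) extends Digraph V where
  loopless : ∀ v, ¬ Adj v v
  adj_xor : ∀ v w, v ≠ w → Xor (Adj v w) (Adj w v)

namespace Tournament

/-- `T` is `H`-free: it does not contain `H` as an induced subtournament. -/
def IsFree {V W : Type*} (H : Tournament V) (T : Tournament W) : Prop :=
  IsEmpty (H.Adj ↪r T.Adj)

/-- The set `S` is transitive in `T`: the subtournament induced by `S` has no directed cycle. -/
def IsTransitiveSet {W : Type*} (T : Tournament W) (S : Finset W) : Prop :=
  ∀ v : S, ¬ Relation.TransGen (fun a b : S => T.Adj a b) v v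

/-- The exponents `e > 0` for which every `H`-free tournament `T` contains a transitive
subtournament of size at least `|T| ^ e`. -/
def ehExponents {V : Type*} (H : Tournament V) : Set ℝ :=
  {e | 0 < e ∧ ∀ (W : Type) [Fintype W] (T : Tournament W), IsFree H T →
    ∃ S : Finset W, T.IsTransitiveSet S ∧ (Fintype.card W : ℝ) ^ e ≤ S.card}

/-- The Erdős–Hajnal coefficient `ε(H)`, the best exponent. If `H` has none, or if the exponents
are unbounded, this is `0` by convention; so `0 < ehCoeff H` says that the supremum is a genuine
one over a nonempty bounded set. -/
noncomputable def ehCoeff {V : Type*} (H : Tournament V) : ℝ :=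
  sSup H.ehExponents

/-- `S` is homogeneous in `H`. -/
def IsHomogeneous {V : Type*} (H : Tournament V) (S : Set V) : Prop :=
  ∀ v ∉ S, (∀ w ∈ S, H.Adj w v) ∨ (∀ w ∈ S, H.Adj v w)

/-- `H` is prime: no homogeneous set `S` has more than one vertex and differs from `V(H)`. -/
def IsPrime {V : Type*} (H : Tournament V) : Prop :=
  ∀ S : Set V, H.IsHomogeneous S → ¬ (S.Nontrivial ∧ S ≠ Set.univ)

/-- The graph of backward edges of `H` under the ordering `θ`. -/
def backwardGraph {V : Type*} {n : ℕ} (H : Tournament V) (θ : V ≃ Fin n) : SimpleGraph V where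
  Adj v w := (H.Adj v w ∧ θ w < θ v) ∨ (H.Adj w v ∧ θ v < θ w)
  symm := ⟨fun _ _ h => Or.symm h⟩
  loopless := ⟨fun v h => by simp at h⟩

/-- `S` induces in the graph of backward edges a star with center `c ∈ S` and at least one leaf,
and `c` precedes all the leaves (left star) or succeeds all of them (right star). -/
def IsStarWithCenter {V : Type*} {n : ℕ} (H : Tournament V) (θ : V ≃ Fin n) (S : Set V) (c : V) :
    Prop :=
  S.Nontrivial ∧
  (∃ hc : c ∈ S, (H.backwardGraph θ).induce S = SimpleGraph.starGraph (⟨c, hc⟩ : S)) ∧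
  ((∀ l ∈ S, l ≠ c → θ c < θ l) ∨ (∀ l ∈ S, l ≠ c → θ l < θ c))

/-- `θ` is a galaxy ordering of `H`: every connected component of the graph of backward edges is a
singleton or a star, and (for some choice of the centers of the stars, which matters only for stars
with two vertices) no center of a star is between two leaves of another star. -/
def IsGalaxyOrdering {V : Type*} {n : ℕ} (H : Tournament V) (θ : V ≃ Fin n) : Prop :=
  ∃ center : (H.backwardGraph θ).ConnectedComponent → V,
    (∀ K : (H.backwardGraph θ).ConnectedComponent,
      (∃ v, K.supp = {v}) ∨ H.IsStarWithCenter θ K.supp (center K)) ∧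
    (∀ K L : (H.backwardGraph θ).ConnectedComponent, K ≠ L →
      K.supp.Nontrivial → L.supp.Nontrivial →
      ∀ a ∈ L.supp, ∀ b ∈ L.supp, a ≠ center L → b ≠ center L →
        ¬ (θ a < θ (center K) ∧ θ (center K) < θ b))

/-- `H` is a galaxy. -/
def IsGalaxy {V : Type*} [Fintype V] (H : Tournament V) : Prop :=
  ∃ θ : V ≃ Fin (Fintype.card V), H.IsGalaxyOrdering θ

end Tournament

/-! The theorem follows from `exponent_le` and `IsGalaxy.mem_ehExponents`: every exponent of `H` is
at most `12 log n / n`, and for a galaxy `1 / (432 n ^ 4)` is an exponent, where `n = |H|`.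

Upper bound: among tournaments on `N = 2 ^ k` vertices, with `k` about `n / 2`, a union bound leaves
one containing neither `H` nor a transitive tournament on `n` vertices (`exists_isFree_isFree`). Its
transitive subsets have fewer than `n` vertices, so `N ^ e ≤ n`.

Lower bound: take a minimal vertex set `S` of an `H`-free tournament with no transitive subset of
size `t = |S| ^ e`, and let `s = c|S|`. By minimality, a proper subset of size at least `s` has a
transitive subset of size almost `t`. Hence no transitive set of size `t / (12n)` is complete to or
from a set of size `s`, since the two transitive sets would combine to one of size `t`.

Nested almost complete pairs (`exists_dense_pair`) give a sequence of `2n` sets in which almost all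
edges go forward. Its members of odd index are large, those of even index are transitive
(`exists_dense_sequence`). Number the centres of the galaxy by odd indices and the intervals between
centres by even ones; the leaves of a star share one interval. Stars are then embedded one at a
time: a centre is sought in its large set, the leaves in disjoint pieces of a transitive set. By
criticality, fewer than `s` candidates for the centre lack a backward edge to the piece of a given
leaf, so some candidate has one for every leaf. This produces `H`, a contradiction
(`IsGalaxy.not_critical`). -/

namespace Tournament

/-! ### Adjacency and transitive sets. -/

theorem not_adj_of_adj {V : Type*} (T : Tournament V) {v w : V} (h : T.Adj v w) : ¬ T.Adj w v := by
  intro h'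
  by_cases e : v = w
  · subst e; exact T.loopless _ h
  · rcases T.adj_xor v w e with h1 | h1
    · exact h1.2 h'
    · exact h1.2 h

theorem ne_of_adj {V : Type*} (T : Tournament V) {v w : V} (h : T.Adj v w) : v ≠ w := by
  rintro rfl
  exact T.loopless _ h

theorem adj_or_adj {V : Type*} (T : Tournament V) {v w : V} (h : v ≠ w) :
    T.Adj v w ∨ T.Adj w v := (T.adj_xor v w h).or

theorem not_adj_iff {V : Type*} (T : Tournament V) {v w : V} (h : v ≠ w) :
    ¬ T.Adj v w ↔ T.Adj w v :=
  ⟨fun h' => (T.adj_or_adj h).resolve_left h', fun h' => T.not_adj_of_adj h'⟩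

/-- A map between tournaments that preserves adjacency is an induced embedding. -/
theorem not_isFree_of_hom {V W : Type*} {H : Tournament V} {T : Tournament W} (φ : V → W)
    (h : ∀ p q, H.Adj p q → T.Adj (φ p) (φ q)) : ¬ IsFree H T := by
  intro hf
  refine hf.false ⟨⟨φ, ?_⟩, ?_⟩
  · intro p q e
    by_contra hne
    rcases H.adj_or_adj hne with h1 | h1
    · exact T.ne_of_adj (h _ _ h1) e
    · exact T.ne_of_adj (h _ _ h1) e.symm
  · intro p q
    refine ⟨fun h1 => ?_, h p q⟩
    have hne : p ≠ q := by
      rintro rfl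
      exact T.loopless _ h1
    exact (H.adj_or_adj hne).resolve_right fun h2 => T.not_adj_of_adj h1 (h _ _ h2)

/-- A path `a → b → c` without the edge `a → c` closes up to a directed triangle; conversely,
transitivity shrinks any cycle to a loop. -/
theorem isTransitiveSet_iff {W : Type*} (T : Tournament W) (S : Finset W) :
    T.IsTransitiveSet S ↔
      ∀ a ∈ S, ∀ b ∈ S, ∀ c ∈ S, T.Adj a b → T.Adj b c → T.Adj a c := by
  constructor
  · intro h a ha b hb c hc hab hbc
    have hac : a ≠ c := by
      rintro rfl
      exact T.not_adj_of_adj hab hbc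
    refine (T.adj_or_adj hac).resolve_right fun hca => ?_
    refine h ⟨a, ha⟩ (Relation.TransGen.tail (b := ⟨c, hc⟩)
      (Relation.TransGen.tail (b := ⟨b, hb⟩) (Relation.TransGen.single ?_) ?_) ?_)
    exacts [hab, hbc, hca]
  · intro h v hv
    have key : ∀ w : S, Relation.TransGen (fun a b : S => T.Adj a b) v w → T.Adj v w := by
      intro w hw
      induction hw with
      | single h1 => exact h1
      | tail _ h2 ih => exact h _ v.2 _ (Subtype.mem _) _ (Subtype.mem _) ih h2
    exact T.loopless _ (key v hv)

/-! ### Upper bound by counting tournaments. -/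

/-- The tournament on `Fin N` coded by a two-colouring of the sets of vertices. -/
def ofColouring {N : ℕ} (f : Finset (Fin N) → Bool) : Tournament (Fin N) where
  -- Only the values of `f` on pairs matter. The values on other sets contribute the same factor to
  -- every count and cancel.
  Adj i j := i ≠ j ∧ (f {i, j} = true ↔ i < j)
  loopless v h := h.1 rfl
  adj_xor v w h := by
    have e : ({w, v} : Finset (Fin N)) = {v, w} := Finset.pair_comm _ _
    rw [e]
    rcases lt_or_gt_of_ne h with h1 | h1 <;> cases f {v, w} <;>
      simp [Xor, h, h.symm, h1, h1.not_gt]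

/-- The transitive tournament on `Fin n`. -/
def transitive (n : ℕ) : Tournament (Fin n) where
  Adj i j := i < j
  loopless v := lt_irrefl v
  adj_xor v w h := by
    rcases lt_or_gt_of_ne h with h1 | h1 <;> simp [Xor, h1, h1.not_gt]

-- If one colouring `f₀` makes `φ` a copy of `H`, any other such colouring agrees with `f₀` on all
-- pairs in the image of `φ`. So a given `φ` works with probability at most `2 ^ (-choose n 2)`.
open scoped Classical in
theorem card_colouring_of_copy {V : Type*} [Fintype V] {N : ℕ} (H : Tournament V)
    (φ : V → Fin N) :
    (Finset.univ.filter fun f : Finset (Fin N) → Bool =>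
        ∀ p q, H.Adj p q → (ofColouring f).Adj (φ p) (φ q)).card
      * 2 ^ (Fintype.card V).choose 2 ≤ 2 ^ Fintype.card (Finset (Fin N)) := by
  set F := Finset.univ.filter fun f : Finset (Fin N) → Bool =>
        ∀ p q, H.Adj p q → (ofColouring f).Adj (φ p) (φ q) with hF
  rcases F.eq_empty_or_nonempty with h0 | ⟨f₀, hf₀⟩
  · simp [h0]
  have hf₀' := (Finset.mem_filter.1 hf₀).2
  have hinj : Function.Injective φ := by
    intro p q e
    by_contra hne
    rcases H.adj_or_adj hne with h1 | h1
    · exact (hf₀' _ _ h1).1 e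
    · exact (hf₀' _ _ h1).1 e.symm
  set E := (Finset.univ.map ⟨φ, hinj⟩).powersetCard 2 with hE
  have hEc : E.card = (Fintype.card V).choose 2 := by
    simp [hE, Finset.card_powersetCard]
  have hsub : F ⊆ Fintype.piFinset fun e => if e ∈ E then {f₀ e} else Finset.univ := by
    intro f hf
    have hf' := (Finset.mem_filter.1 hf).2
    rw [Fintype.mem_piFinset]
    intro e
    split_ifs with he
    · rw [Finset.mem_singleton]
      obtain ⟨hes, hec⟩ := Finset.mem_powersetCard.1 he
      obtain ⟨x, y, hxy, rfl⟩ := Finset.card_eq_two.1 hec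
      have hx := hes (Finset.mem_insert_self x {y})
      have hy := hes (Finset.mem_insert_of_mem (Finset.mem_singleton_self y) : y ∈ {x, y})
      simp only [Finset.mem_map, Finset.mem_univ, Function.Embedding.coeFn_mk, true_and] at hx hy
      obtain ⟨p, rfl⟩ := hx
      obtain ⟨q, rfl⟩ := hy
      have hpq : p ≠ q := fun h => hxy (h ▸ rfl)
      rcases H.adj_or_adj hpq with h1 | h1
      · exact Bool.eq_iff_iff.2 ((hf' _ _ h1).2.trans (hf₀' _ _ h1).2.symm)
      · rw [Finset.pair_comm]
        exact Bool.eq_iff_iff.2 ((hf' _ _ h1).2.trans (hf₀' _ _ h1).2.symm)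
    · exact Finset.mem_univ _
  have hcard := Finset.card_le_card hsub
  rw [Fintype.card_piFinset] at hcard
  have hprod : ∏ e : Finset (Fin N), (if e ∈ E then {f₀ e} else Finset.univ : Finset Bool).card
      = 2 ^ (Eᶜ).card := by
    rw [← Finset.prod_mul_prod_compl E]
    rw [Finset.prod_congr rfl (g := fun _ => 1), Finset.prod_congr (s₁ := Eᶜ) rfl (g := fun _ => 2)]
    · simp
    · intro e he
      simp [Finset.mem_compl.1 he]
    · intro e he
      simp [he]
  rw [hprod] at hcard
  calc F.card * 2 ^ (Fintype.card V).choose 2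
      ≤ 2 ^ (Eᶜ).card * 2 ^ E.card := by rw [hEc]; gcongr
    _ = _ := by rw [← pow_add, Finset.card_compl, Nat.sub_add_cancel (Finset.card_le_univ E)]

open scoped Classical in
/-- A counting argument: some tournament avoids two given tournaments of equal order. -/
theorem exists_isFree_isFree {U V : Type*} [Fintype U] [Fintype V] {n N : ℕ}
    (hU : Fintype.card U = n) (hV : Fintype.card V = n)
    (hN : 2 * N ^ n < 2 ^ n.choose 2) (G : Tournament U) (H : Tournament V) :
    ∃ T : Tournament (Fin N), IsFree G T ∧ IsFree H T := by
  by_contra! hcon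
  set M := 2 ^ Fintype.card (Finset (Fin N))
  let F₁ : (U → Fin N) → Finset (Finset (Fin N) → Bool) := fun φ =>
    Finset.univ.filter fun f => ∀ p q, G.Adj p q → (ofColouring f).Adj (φ p) (φ q)
  let F₂ : (V → Fin N) → Finset (Finset (Fin N) → Bool) := fun φ =>
    Finset.univ.filter fun f => ∀ p q, H.Adj p q → (ofColouring f).Adj (φ p) (φ q)
  have hcover : (Finset.univ : Finset (Finset (Fin N) → Bool)) ⊆
      Finset.univ.biUnion F₁ ∪ Finset.univ.biUnion F₂ := by
    intro f _
    rw [Finset.mem_union, Finset.mem_biUnion, Finset.mem_biUnion]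
    by_cases hG : IsFree G (ofColouring f)
    · have h := hcon _ hG
      rw [IsFree, not_isEmpty_iff] at h
      obtain ⟨e⟩ := h
      exact Or.inr ⟨e, Finset.mem_univ _, Finset.mem_filter.2
        ⟨Finset.mem_univ _, fun p q h => e.map_rel_iff.2 h⟩⟩
    · rw [IsFree, not_isEmpty_iff] at hG
      obtain ⟨e⟩ := hG
      exact Or.inl ⟨e, Finset.mem_univ _, Finset.mem_filter.2
        ⟨Finset.mem_univ _, fun p q h => e.map_rel_iff.2 h⟩⟩
  have hM : (Finset.univ : Finset (Finset (Fin N) → Bool)).card = M := by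
    simp [M]
  have h1 : (Finset.univ.biUnion F₁).card * 2 ^ n.choose 2 ≤ N ^ n * M := by
    calc _ ≤ (∑ φ, (F₁ φ).card) * 2 ^ n.choose 2 := by gcongr; exact Finset.card_biUnion_le
      _ = ∑ φ, (F₁ φ).card * 2 ^ n.choose 2 := Finset.sum_mul _ _ _
      _ ≤ ∑ _φ : U → Fin N, M := Finset.sum_le_sum fun φ _ => by
          rw [← hU]; exact card_colouring_of_copy G φ
      _ = N ^ n * M := by simp [hU]
  have h2 : (Finset.univ.biUnion F₂).card * 2 ^ n.choose 2 ≤ N ^ n * M := by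
    calc _ ≤ (∑ φ, (F₂ φ).card) * 2 ^ n.choose 2 := by gcongr; exact Finset.card_biUnion_le
      _ = ∑ φ, (F₂ φ).card * 2 ^ n.choose 2 := Finset.sum_mul _ _ _
      _ ≤ ∑ _φ : V → Fin N, M := Finset.sum_le_sum fun φ _ => by
          rw [← hV]; exact card_colouring_of_copy H φ
      _ = N ^ n * M := by simp [hV]
  have h3 := (Finset.card_le_card hcover).trans (Finset.card_union_le _ _)
  rw [hM] at h3
  have hMpos : 0 < M := by positivity
  have : M * 2 ^ n.choose 2 ≤ M * (2 * N ^ n) := by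
    calc M * 2 ^ n.choose 2 ≤ _ := Nat.mul_le_mul_right _ h3
      _ ≤ _ := by rw [add_mul]; linarith
  exact absurd (Nat.le_of_mul_le_mul_left this hMpos) (not_le.2 hN)

/-- The position of `x` in the transitive set `X`. -/
noncomputable def rank {W : Type*} (T : Tournament W) (X : Finset W) (x : W) : ℕ := by
  classical exact (X.filter fun y => T.Adj y x).card

theorem rank_lt_rank {W : Type*} {T : Tournament W} {X : Finset W} (hX : T.IsTransitiveSet X)
    {x y : W} (hx : x ∈ X) (hy : y ∈ X) (h : T.Adj x y) : T.rank X x < T.rank X y := by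
  classical
  rw [isTransitiveSet_iff] at hX
  refine Finset.card_lt_card ⟨fun z hz => ?_, fun hs => ?_⟩
  · rw [Finset.mem_filter] at hz ⊢
    exact ⟨hz.1, hX _ hz.1 _ hx _ hy hz.2 h⟩
  · exact T.loopless x (Finset.mem_filter.1 (hs (Finset.mem_filter.2 ⟨hx, h⟩))).2

theorem adj_of_rank_lt {W : Type*} {T : Tournament W} {X : Finset W} (hX : T.IsTransitiveSet X)
    {x y : W} (hx : x ∈ X) (hy : y ∈ X) (h : T.rank X x < T.rank X y) : T.Adj x y := by
  have hne : x ≠ y := by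
    rintro rfl
    exact lt_irrefl _ h
  exact (T.adj_or_adj hne).resolve_right fun h' => (rank_lt_rank hX hy hx h').not_gt h

/-- The rank is injective on a transitive set and stays below its size. This allows such a set to be
indexed, and later to be cut into consecutive pieces. -/
theorem image_rank {W : Type*} {T : Tournament W} {X : Finset W} (hX : T.IsTransitiveSet X) :
    X.image (T.rank X) = Finset.range X.card := by
  classical
  apply Finset.eq_of_subset_of_card_le
  · intro k hk
    obtain ⟨x, hx, rfl⟩ := Finset.mem_image.1 hk
    rw [Finset.mem_range]
    exact Finset.card_lt_card ⟨Finset.filter_subset _ _, fun hs =>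
      T.loopless x (Finset.mem_filter.1 (hs hx)).2⟩
  · rw [Finset.card_range, Finset.card_image_of_injOn]
    intro x hx y hy e
    by_contra hne
    rcases T.adj_or_adj hne with h | h
    · exact (rank_lt_rank hX hx hy h).ne e
    · exact (rank_lt_rank hX hy hx h).ne e.symm

/-- A transitive set of at least `n` vertices contains a copy of the transitive tournament. -/
theorem not_isFree_transitive {W : Type*} {T : Tournament W} {X : Finset W}
    (hX : T.IsTransitiveSet X) {n : ℕ} (hn : n ≤ X.card) : ¬ IsFree (transitive n) T := by
  have h : ∀ i : Fin n, ∃ x ∈ X, T.rank X x = i := by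
    intro i
    have : (i : ℕ) ∈ X.image (T.rank X) := by
      rw [image_rank hX, Finset.mem_range]
      exact i.2.trans_le hn
    simpa using this
  choose φ hφ hr using h
  refine not_isFree_of_hom φ fun p q hpq => adj_of_rank_lt hX (hφ p) (hφ q) ?_
  rw [hr, hr]
  exact hpq

/-- The two-vertex tournament is too small to contain `H`, and forces `2 ^ e ≤ 2`. This serves the
case `n = 3`, where the counting argument says nothing. -/
theorem exponent_le_one {V : Type*} [Fintype V] (H : Tournament V) (hV : 3 ≤ Fintype.card V)
    {e : ℝ} (he : e ∈ H.ehExponents) : e ≤ 1 := by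
  obtain ⟨-, h⟩ := he
  obtain ⟨S, -, hS⟩ := h (Fin 2) (transitive 2) ⟨fun φ => by
    have := Fintype.card_le_of_injective _ φ.injective
    simp at this
    omega⟩
  have h2 : (S.card : ℝ) ≤ 2 := by
    have := Finset.card_le_univ S
    simp at this
    exact_mod_cast this
  have h3 : (2 : ℝ) ^ e ≤ 2 ^ (1 : ℝ) := by
    simpa using hS.trans h2
  exact (Real.rpow_le_rpow_left_iff (by norm_num)).1 h3

/-- Every Erdős–Hajnal exponent of a tournament with `n` vertices is `O(log n / n)`. -/
theorem exponent_le {V : Type*} [Fintype V] (H : Tournament V) (hV : 3 ≤ Fintype.card V)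
    {e : ℝ} (he : e ∈ H.ehExponents) :
    e ≤ 12 * Real.log (Fintype.card V) / Fintype.card V := by
  set n := Fintype.card V with hn
  have hlog : 1 ≤ Real.log n := by
    rw [Real.le_log_iff_exp_le (by positivity)]
    have : (3 : ℝ) ≤ n := by exact_mod_cast hV
    linarith [Real.exp_one_lt_d9]
  have hn0 : (0 : ℝ) < n := by positivity
  rcases hV.eq_or_lt with h3 | h4
  · refine (H.exponent_le_one hV he).trans ?_
    rw [le_div_iff₀ hn0, ← h3]
    rw [← h3] at hlog
    push_cast at hlog ⊢
    linarith
  -- The tournament will have `2 ^ k` vertices. The union bound needs `1 + k n < n (n - 1) / 2`,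
  -- which `2 k + 2 ≤ n` ensures; `n ≤ 8 k` turns the bound in `k` back into one in `n`.
  obtain ⟨k, hk⟩ : ∃ k, k = (n - 2) / 2 := ⟨_, rfl⟩
  have hk1 : 2 * k + 2 ≤ n := by omega
  have hk2 : n ≤ 8 * k := by omega
  have hN : 2 * (2 ^ k) ^ n < 2 ^ n.choose 2 := by
    rw [← pow_mul, ← pow_succ']
    apply Nat.pow_lt_pow_right (by norm_num)
    rw [Nat.choose_two_right, Nat.lt_iff_add_one_le, Nat.le_div_iff_mul_le (by norm_num)]
    obtain ⟨m, hm⟩ : ∃ m, n = 2 * k + 2 + m := ⟨n - (2 * k + 2), by omega⟩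
    rw [show n - 1 = 2 * k + 1 + m by omega]
    rw [hm] at h4 ⊢
    ring_nf at h4 ⊢
    nlinarith [Nat.zero_le (k * m), Nat.zero_le (m * m)]
  obtain ⟨T, hT1, hT2⟩ := exists_isFree_isFree (Fintype.card_fin n) hn.symm hN (transitive n) H
  obtain ⟨S, hS, hSc⟩ := he.2 _ T hT2
  have hlt : S.card < n := by
    by_contra! hle
    exact not_isFree_transitive hS hle hT1
  have h5 : ((2 : ℝ) ^ k) ^ e ≤ n := by
    have : (S.card : ℝ) ≤ n := by exact_mod_cast hlt.le
    simpa using hSc.trans this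
  have h6 := Real.log_le_log (by positivity) h5
  rw [Real.log_rpow (by positivity), Real.log_pow] at h6
  have hk2' : (n : ℝ) ≤ 8 * k := by exact_mod_cast hk2
  have hl2 := Real.log_two_gt_d9
  have he0 := he.1
  rw [le_div_iff₀ hn0]
  calc e * n ≤ e * (8 * k) := by gcongr
    _ ≤ 12 * (e * (k * Real.log 2)) := by
      have : 0 ≤ e * k := by positivity
      nlinarith
    _ ≤ 12 * Real.log n := by linarith

/-! ### Almost complete pairs and sequences of sets. -/

/-- `v` is not adjacent to `w`. -/
def NonAdj {V : Type*} (T : Tournament V) (v w : V) : Prop := ¬ T.Adj v w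

open scoped Classical in
/-- Markov's inequality for the degrees in a sparse bipartite relation. -/
theorem card_mul_le_of_sparse {α β : Type*} (r : α → β → Prop) (A : Finset α) (B : Finset β)
    {l K : ℝ} (hl : 0 < l) (_hK : 0 < K)
    (h : ∀ a ∈ A, ((B.filter fun b => r a b).card : ℝ) ≤ l * B.card) :
    K * (B.filter fun b => K * l * A.card < (A.filter fun a => r a b).card).card ≤ B.card := by
  set C := B.filter fun b => K * l * A.card < (A.filter fun a => r a b).card with hC
  rcases A.eq_empty_or_nonempty with rfl | hA
  · have : C = ∅ := by simp [hC]
    simp [this]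
  have hApos : (0 : ℝ) < A.card := by exact_mod_cast hA.card_pos
  have h1 : (C.card : ℝ) * (K * l * A.card) ≤ ∑ b ∈ C, ((A.filter fun a => r a b).card : ℝ) := by
    rw [← nsmul_eq_mul]
    exact Finset.card_nsmul_le_sum _ _ _ fun b hb => (Finset.mem_filter.1 hb).2.le
  have h2 : ∑ b ∈ C, ((A.filter fun a => r a b).card : ℝ) ≤
      ∑ b ∈ B, ((A.filter fun a => r a b).card : ℝ) :=
    Finset.sum_le_sum_of_subset_of_nonneg (Finset.filter_subset _ _) fun _ _ _ => by positivity
  have h3 : ∑ b ∈ B, ((A.filter fun a => r a b).card : ℝ) =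
      ∑ a ∈ A, ((B.filter fun b => r a b).card : ℝ) := by
    have := Finset.sum_card_bipartiteAbove_eq_sum_card_bipartiteBelow (s := A) (t := B) r
    simp only [Finset.bipartiteAbove, Finset.bipartiteBelow] at this
    exact_mod_cast this.symm
  have h4 : ∑ a ∈ A, ((B.filter fun b => r a b).card : ℝ) ≤ A.card * (l * B.card) := by
    rw [← nsmul_eq_mul]
    exact Finset.sum_le_card_nsmul _ _ _ h
  have h5 : (l * A.card) * (K * C.card) ≤ (l * A.card) * B.card := by
    calc _ = C.card * (K * l * A.card) := by ring
      _ ≤ A.card * (l * B.card) := by linarith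
      _ = _ := by ring
  exact le_of_mul_le_mul_left h5 (by positivity)

open scoped Classical in
theorem card_le_two_mul_of_sparse {α β : Type*} (r : α → β → Prop) (A : Finset α) (B : Finset β)
    {l : ℝ} (hl : 0 < l)
    (h : ∀ a ∈ A, ((B.filter fun b => r a b).card : ℝ) ≤ l * B.card) :
    (B.card : ℝ) ≤
      2 * (B.filter fun b => ((A.filter fun a => r a b).card : ℝ) ≤ 2 * l * A.card).card := by
  have h1 := card_mul_le_of_sparse r A B hl (two_pos) h
  have h2 := Finset.card_filter_add_card_filter_not (s := B)
    (fun b => ((A.filter fun a => r a b).card : ℝ) ≤ 2 * l * A.card)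
  simp only [not_le] at h2
  have h3 : ((B.filter fun b => ((A.filter fun a => r a b).card : ℝ) ≤ 2 * l * A.card).card : ℝ) +
    (B.filter fun b => 2 * l * A.card < ((A.filter fun a => r a b).card : ℝ)).card = B.card := by
    exact_mod_cast h2
  linarith

open scoped Classical in
/-- Either an `l`-sparse pair of large sets, or a partial copy of `H` on `P`
that can be extended further. -/
theorem exists_sparse_or_partial_copy {V W : Type*} [Fintype V] {H : Tournament V}
    {T : Tournament W} {l s : ℝ} (hl0 : 0 < l) (hl1 : l ≤ 1) (Z : V → Finset W)
    (hs : ∀ v, s ≤ (Z v).card)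
    (hno : ∀ p q, ∀ A ⊆ Z p, ∀ B ⊆ Z q, p ≠ q → l ^ Fintype.card V * s ≤ Fintype.card V * A.card →
      l ^ Fintype.card V * s ≤ B.card →
      ¬ ((∀ a ∈ A, ((B.filter fun b => T.Adj a b).card : ℝ) < l * B.card) ∨
        (∀ a ∈ A, ((B.filter fun b => T.Adj b a).card : ℝ) < l * B.card)))
    (hs0 : 0 < s) (P : Finset V) :
    ∃ (φ : V → W) (U : V → Finset W), (∀ v, U v ⊆ Z v) ∧
      (∀ v ∉ P, l ^ P.card * s ≤ (U v).card) ∧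
      (∀ p ∈ P, ∀ q ∈ P, H.Adj p q → T.Adj (φ p) (φ q)) ∧
      (∀ p ∈ P, ∀ q ∉ P, ∀ w ∈ U q,
        (H.Adj p q → T.Adj (φ p) w) ∧ (H.Adj q p → T.Adj w (φ p))) := by
  induction P using Finset.induction_on with
  | empty =>
    have : Nonempty (V → W) := by
      refine ⟨fun v => ?_⟩
      have : (Z v).Nonempty := by
        rw [← Finset.card_pos]
        exact_mod_cast hs0.trans_le (hs v)
      exact this.choose
    refine ⟨this.some, Z, fun v => Finset.Subset.refl _, ?_, ?_, ?_⟩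
    · intro v _; simpa using hs v
    · intro p hp; simp at hp
    · intro p hp; simp at hp
  | insert p P hp ih =>
    obtain ⟨φ, U, hU, hc, hφ, hφU⟩ := ih
    have hPn : P.card < Fintype.card V := by
      have := Finset.card_le_univ (insert p P)
      rw [Finset.card_insert_of_notMem hp] at this
      omega
    have hpow : l ^ Fintype.card V * s ≤ l ^ P.card * s := by
      apply mul_le_mul_of_nonneg_right _ hs0.le
      exact pow_le_pow_of_le_one hl0.le hl1 hPn.le
    let good : W → V → Finset W := fun w q => (U q).filter fun x =>
      (H.Adj p q → T.Adj w x) ∧ (H.Adj q p → T.Adj x w)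
    -- If every `w` shrinks some `U q` below the fraction `l`, one `q` is to blame for at least `1 /
    -- n` of `U p`. That part of `U p` and `U q` form a sparse pair, which is why `hno` has the
    -- factor `n` on the side of `A`.
    have hex : ∃ w ∈ U p, ∀ q ∉ insert p P, l * (U q).card ≤ (good w q).card := by
      by_contra! hcon
      have hUp : (U p) ⊆ (Finset.univ.filter fun q => q ∉ insert p P).biUnion fun q =>
          (U p).filter fun w => ((good w q).card : ℝ) < l * (U q).card := by
        intro w hw
        obtain ⟨q, hq1, hq2⟩ := hcon w hw
        exact Finset.mem_biUnion.2 ⟨q, by simpa using hq1, Finset.mem_filter.2 ⟨hw, hq2⟩⟩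
      have hUp0 : (U p).Nonempty := by
        rw [← Finset.card_pos]
        have : (0 : ℝ) < (U p).card := lt_of_lt_of_le (by positivity) (hc p hp)
        exact_mod_cast this
      obtain ⟨q, hq, hqc⟩ : ∃ q ∈ (Finset.univ.filter fun q => q ∉ insert p P),
          (U p).card ≤ Fintype.card V *
            ((U p).filter fun w => ((good w q).card : ℝ) < l * (U q).card).card := by
        by_contra! h
        have h1 := (Finset.card_le_card hUp).trans Finset.card_biUnion_le
        have h0 : (Finset.univ.filter fun q => q ∉ insert p P).Nonempty := by
          obtain ⟨w, hw⟩ := hUp0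
          obtain ⟨q, hq, -⟩ := hcon w hw
          exact ⟨q, by simpa using hq⟩
        have h2 := Finset.sum_lt_sum_of_nonempty h0 h
        rw [← Finset.mul_sum, Finset.sum_const, smul_eq_mul] at h2
        have h3 := Finset.card_le_univ (Finset.univ.filter fun q => q ∉ insert p P)
        nlinarith
      have hqp : q ≠ p ∧ q ∉ P := by simpa using hq
      refine hno p q ((U p).filter fun w => ((good w q).card : ℝ) < l * (U q).card)
        ((Finset.filter_subset _ _).trans (hU p)) (U q) (hU q) hqp.1.symm
        ((hpow.trans (hc p hp)).trans (by exact_mod_cast hqc)) (hpow.trans (hc q hqp.2)) ?_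
      rcases H.adj_or_adj hqp.1 with h1 | h1
      · right
        intro a ha
        have := (Finset.mem_filter.1 ha).2
        simpa [good, h1, H.not_adj_of_adj h1] using this
      · left
        intro a ha
        have := (Finset.mem_filter.1 ha).2
        simpa [good, h1, H.not_adj_of_adj h1] using this
    obtain ⟨w, hw, hwg⟩ := hex
    refine ⟨Function.update φ p w, fun q => good w q, ?_, ?_, ?_, ?_⟩
    · exact fun v => (Finset.filter_subset _ _).trans (hU v)
    · intro v hv
      rw [Finset.card_insert_of_notMem hp]
      have hv' : v ∉ P := fun h => hv (Finset.mem_insert_of_mem h)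
      calc l ^ (P.card + 1) * s = l * (l ^ P.card * s) := by ring
        _ ≤ l * (U v).card := by gcongr; exact hc v hv'
        _ ≤ _ := hwg v hv
    · intro a ha b hb hab
      have hne := H.ne_of_adj hab
      by_cases ea : a = p
      · subst ea
        have hb' : b ∈ P := (Finset.mem_insert.1 hb).resolve_left hne.symm
        rw [Function.update_self, Function.update_of_ne hne.symm]
        exact (hφU b hb' a hp w hw).2 hab
      · have ha' : a ∈ P := (Finset.mem_insert.1 ha).resolve_left ea
        rw [Function.update_of_ne ea]
        by_cases eb : b = p
        · subst eb
          rw [Function.update_self]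
          exact (hφU a ha' b hp w hw).1 hab
        · rw [Function.update_of_ne eb]
          exact hφ a ha' b ((Finset.mem_insert.1 hb).resolve_left eb) hab
    · intro a ha q hq x hx
      have hq' : q ∉ P := fun h => hq (Finset.mem_insert_of_mem h)
      have hx' := Finset.mem_filter.1 hx
      by_cases ea : a = p
      · subst ea
        rw [Function.update_self]
        exact hx'.2
      · rw [Function.update_of_ne ea]
        exact hφU a ((Finset.mem_insert.1 ha).resolve_left ea) q hq' x hx'.1

theorem exists_disjoint_family {V W : Type*} [Fintype V] [Nonempty V] (U : Finset W) :
    ∃ Z : V → Finset W, (∀ v, Z v ⊆ U) ∧ (∀ v w, v ≠ w → Disjoint (Z v) (Z w)) ∧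
      ∀ v, (Z v).card = U.card / Fintype.card V := by
  classical
  set n := Fintype.card V with hn
  have hn0 : 0 < n := Fintype.card_pos
  let e := Fintype.equivFin V
  let k := U.card / n
  have hk : n * k ≤ U.card := Nat.mul_div_le _ _
  let g := U.equivFin
  have hlt : ∀ (v : V) (i : Fin k), (e v : ℕ) * k + i < U.card := fun v i => by
    have h1 : ((e v : ℕ) + 1) * k ≤ n * k := Nat.mul_le_mul_right _ (e v).2
    have := i.2
    nlinarith
  let ι : V → Fin k → W := fun v i => (g.symm ⟨(e v : ℕ) * k + i, hlt v i⟩ : U)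
  have hι : ∀ v i w j, ι v i = ι w j → v = w ∧ i = j := by
    intro v i w j h
    have h1 := congrArg Fin.val (g.symm.injective (Subtype.ext h))
    simp only at h1
    have hkpos : 0 < k := i.pos
    have h2 := congrArg (· / k) h1
    have h3 := congrArg (· % k) h1
    simp only [mul_comm _ k, Nat.mul_add_div hkpos, Nat.div_eq_of_lt i.2, Nat.div_eq_of_lt j.2,
      Nat.mul_add_mod, Nat.mod_eq_of_lt i.2, Nat.mod_eq_of_lt j.2, add_zero] at h2 h3
    exact ⟨e.injective (Fin.ext h2), Fin.ext h3⟩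
  refine ⟨fun v => Finset.univ.image (ι v), fun v x hx => ?_, fun v w hvw => ?_, fun v => ?_⟩
  · obtain ⟨i, -, rfl⟩ := Finset.mem_image.1 hx
    exact Subtype.mem _
  · rw [Finset.disjoint_left]
    intro x hx hy
    obtain ⟨i, -, rfl⟩ := Finset.mem_image.1 hx
    obtain ⟨j, -, hj⟩ := Finset.mem_image.1 hy
    exact hvw (hι _ _ _ _ hj).1.symm
  · rw [Finset.card_image_of_injective _ fun i j h => (hι _ _ _ _ h).2]
    simp [k]

open scoped Classical in
/-- A set of vertices of an `H`-free tournament contains an almost complete pair of sets. -/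
theorem exists_dense_pair {V W : Type*} [Fintype V] [Nonempty V] {H : Tournament V}
    {T : Tournament W} (hT : IsFree H T) {l : ℝ} (hl0 : 0 < l) (hl1 : l ≤ 1) (U : Finset W)
    (hU : Fintype.card V ≤ U.card) :
    ∃ A ⊆ U, ∃ B ⊆ U, Disjoint A B ∧
      (U.card : ℝ) ≤ 4 * Fintype.card V ^ 2 * (2 / l) ^ Fintype.card V * A.card ∧
      (U.card : ℝ) ≤ 4 * Fintype.card V ^ 2 * (2 / l) ^ Fintype.card V * B.card ∧
      ∀ a ∈ A, ((B.filter fun b => T.NonAdj a b).card : ℝ) ≤ l * B.card := by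
  set n := Fintype.card V with hn
  have hn0 : 0 < n := Fintype.card_pos
  have hn1 : (1 : ℝ) ≤ n := by exact_mod_cast hn0
  obtain ⟨Z, hZU, hZd, hZc⟩ := exists_disjoint_family (V := V) U
  set s : ℝ := (U.card : ℝ) / (2 * n) with hs
  have hUpos : (0 : ℝ) < U.card := by exact_mod_cast hn0.trans_le hU
  have hs0 : 0 < s := by positivity
  have hsZ : ∀ v, s ≤ (Z v).card := by
    intro v
    rw [hZc, hs, div_le_iff₀ (by positivity)]
    have h1 : U.card ≤ (U.card / n) * (2 * n) := by
      have h2 := Nat.div_add_mod U.card n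
      have h3 := Nat.mod_lt U.card hn0
      have h4 : 1 ≤ U.card / n := (Nat.one_le_div_iff hn0).2 hU
      nlinarith
    exact_mod_cast h1
  by_contra! hcon
  have hno : ∀ p q, ∀ A ⊆ Z p, ∀ B ⊆ Z q, p ≠ q → (l / 2) ^ n * s ≤ n * A.card →
      (l / 2) ^ n * s ≤ B.card →
      ¬ ((∀ a ∈ A, ((B.filter fun b => T.Adj a b).card : ℝ) < l / 2 * B.card) ∨
        (∀ a ∈ A, ((B.filter fun b => T.Adj b a).card : ℝ) < l / 2 * B.card)) := by
    intro p q A hA B hB hpq hAc hBc h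
    have hpw : (2 / l) ^ n * (l / 2) ^ n = 1 := by
      rw [← mul_pow]
      have : 2 / l * (l / 2) = 1 := by field_simp
      rw [this, one_pow]
    have hUA : (U.card : ℝ) ≤ 2 * n ^ 2 * (2 / l) ^ n * A.card := by
      calc (U.card : ℝ) = 2 * n * s * ((2 / l) ^ n * (l / 2) ^ n) := by
            rw [hpw, hs]; field_simp
        _ = 2 * n * (2 / l) ^ n * ((l / 2) ^ n * s) := by ring
        _ ≤ 2 * n * (2 / l) ^ n * (n * A.card) := by gcongr
        _ = _ := by ring
    have hUB : (U.card : ℝ) ≤ 2 * n ^ 2 * (2 / l) ^ n * B.card := by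
      calc (U.card : ℝ) = 2 * n * s * ((2 / l) ^ n * (l / 2) ^ n) := by
            rw [hpw, hs]; field_simp
        _ = 2 * n * (2 / l) ^ n * ((l / 2) ^ n * s) := by ring
        _ ≤ 2 * n * (2 / l) ^ n * (n * B.card) := by
            exact mul_le_mul_of_nonneg_left
              (hBc.trans (le_mul_of_one_le_left (by positivity) hn1)) (by positivity)
        _ = _ := by ring
    have hd : Disjoint A B := (hZd p q hpq).mono hA hB
    have hAB : ∀ a ∈ A, ∀ b ∈ B, a ≠ b := fun a ha b hb e =>
      Finset.disjoint_left.1 hd ha (e ▸ hb)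
    rcases h with h | h
    -- Here almost all edges go from `B` to `A`, while the degrees are bounded at the vertices of
    -- `A`. Markov's inequality moves the bound to half of `B` and doubles `l / 2` to `l`.
    · have h1 := card_le_two_mul_of_sparse (fun a b => T.Adj a b) A B (half_pos hl0)
        fun a ha => (h a ha).le
      set B' := B.filter fun b => ((A.filter fun a => T.Adj a b).card : ℝ) ≤ 2 * (l / 2) * A.card
        with hB'
      obtain ⟨b, hb, hbc⟩ := hcon B' (((Finset.filter_subset _ _).trans hB).trans (hZU q)) A
        (hA.trans (hZU p)) ((hd.mono_right (Finset.filter_subset _ _)).symm) (by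
          calc (U.card : ℝ) ≤ 2 * n ^ 2 * (2 / l) ^ n * B.card := hUB
            _ ≤ 2 * n ^ 2 * (2 / l) ^ n * (2 * B'.card) := by gcongr
            _ = _ := by ring)
        (hUA.trans (by gcongr; norm_num))
      have hb' := Finset.mem_filter.1 hb
      refine absurd hbc (not_lt.2 ?_)
      have e : (A.filter fun a => T.NonAdj b a) = A.filter fun a => T.Adj a b :=
        Finset.filter_congr fun a ha => T.not_adj_iff (hAB a ha b hb'.1).symm
      rw [e]
      calc _ ≤ _ := hb'.2
        _ = _ := by ring
    · obtain ⟨a, ha, hac⟩ := hcon A (hA.trans (hZU p)) B (hB.trans (hZU q)) hd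
        (hUA.trans (by gcongr; norm_num)) (hUB.trans (by gcongr; norm_num))
      have e : (B.filter fun b => T.NonAdj a b) = B.filter fun b => T.Adj b a :=
        Finset.filter_congr fun b hb => T.not_adj_iff (hAB a ha b hb)
      rw [e] at hac
      have := h a ha
      have h0 : (0 : ℝ) ≤ B.card := by positivity
      nlinarith
  obtain ⟨φ, -, -, -, hφ, -⟩ := exists_sparse_or_partial_copy (H := H) (half_pos hl0)
    (by linarith) Z hsZ hno hs0 Finset.univ
  exact not_isFree_of_hom φ (fun p q => hφ p (Finset.mem_univ _) q (Finset.mem_univ _)) hT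

open scoped Classical in
/-- Nested almost complete pairs give a long almost complete sequence of sets,
whose types `Q i` can be prescribed. -/
theorem exists_dense_sequence {W : Type*} {T : Tournament W} {l D s : ℝ} (hl0 : 0 < l)
    (hD : 1 ≤ D) (hs : 0 ≤ s)
    (hpair : ∀ U : Finset W, s ≤ U.card → ∃ A ⊆ U, ∃ B ⊆ U, Disjoint A B ∧
      (U.card : ℝ) ≤ D * A.card ∧ (U.card : ℝ) ≤ D * B.card ∧
      ∀ a ∈ A, ((B.filter fun b => T.NonAdj a b).card : ℝ) ≤ l * B.card)
    (m : ℕ) (Q : ℕ → Finset W → Prop) (U : Finset W)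
    (hQ : ∀ i, ∀ A ⊆ U, s ≤ A.card → ∃ Y ⊆ A, Q i Y) (hU : (2 * D) ^ m * s ≤ U.card) :
    ∃ Y : ℕ → Finset W, (∀ i < m, Y i ⊆ U ∧ Q i (Y i)) ∧
      ∀ i j, i < j → j < m → Disjoint (Y i) (Y j) ∧ ∀ y ∈ Y j,
        (((Y i).filter fun x => T.NonAdj x y).card : ℝ) ≤ 2 * l * (Y i).card := by
  induction m generalizing Q U with
  | zero => exact ⟨fun _ => ∅, fun i hi => absurd hi (Nat.not_lt_zero _),
      fun i j _ hj => absurd hj (Nat.not_lt_zero _)⟩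
  | succ m ih =>
    have hDm : 1 ≤ (2 * D) ^ m := one_le_pow₀ (by linarith)
    have hU1 : 2 * D * ((2 * D) ^ m * s) ≤ U.card := by
      calc _ = (2 * D) ^ (m + 1) * s := by ring
        _ ≤ _ := hU
    have hU2 : D * s ≤ U.card := by nlinarith [mul_le_mul_of_nonneg_right hDm hs]
    obtain ⟨A, hA, B, hB, hd, hUA, hUB, hAB⟩ := hpair U (by nlinarith)
    have hDpos : 0 < D := by linarith
    obtain ⟨Y₀, hY₀, hQ₀⟩ := hQ 0 A hA (le_of_mul_le_mul_left (hU2.trans hUA) hDpos)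
    -- The bound at each vertex of `A` is inherited by any subset `Y₀`, however small. So `Y₀` may
    -- be a tiny transitive set, and half of `B` still sees almost all of it.
    have h1 := card_le_two_mul_of_sparse (fun a b => T.NonAdj a b) Y₀ B hl0
        fun a ha => hAB a (hY₀ ha)
    set B' := B.filter fun b =>
      ((Y₀.filter fun a => T.NonAdj a b).card : ℝ) ≤ 2 * l * Y₀.card with hB'
    have hB'U : B' ⊆ U := (Finset.filter_subset _ _).trans hB
    obtain ⟨Y, hY, hYd⟩ := ih (fun i => Q (i + 1)) B'
      (fun i A hA => hQ (i + 1) A (hA.trans hB'U)) (by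
        have h2 : D * (2 * ((2 * D) ^ m * s)) ≤ D * (2 * B'.card) := by
          calc _ = 2 * D * ((2 * D) ^ m * s) := by ring
            _ ≤ D * B.card := hU1.trans hUB
            _ ≤ _ := mul_le_mul_of_nonneg_left h1 hDpos.le
        linarith [le_of_mul_le_mul_left h2 hDpos])
    refine ⟨fun i => Nat.casesOn i Y₀ Y, ?_, ?_⟩
    · rintro (_ | i) hi
      · exact ⟨hY₀.trans hA, hQ₀⟩
      · exact ⟨(hY i (by omega)).1.trans hB'U, (hY i (by omega)).2⟩
    · rintro (_ | i) (_ | j) hij hj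
      · omega
      · have hYj := (hY j (by omega)).1
        exact ⟨hd.mono hY₀ (hYj.trans (Finset.filter_subset _ _)),
          fun y hy => (Finset.mem_filter.1 (hYj hy)).2⟩
      · omega
      · exact hYd i j (by omega) (by omega)

open scoped Classical in
/-- Deleting at most half of each set makes the density condition symmetric. -/
theorem exists_cleaned_sequence {W : Type*} {T : Tournament W} {l : ℝ} (hl0 : 0 < l) {m : ℕ}
    (hm : 0 < m) (Y : ℕ → Finset W)
    (hY : ∀ i j, i < j → j < m → ∀ y ∈ Y j,
        (((Y i).filter fun x => T.NonAdj x y).card : ℝ) ≤ l * (Y i).card) :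
    ∃ Y' : ℕ → Finset W, (∀ i, Y' i ⊆ Y i) ∧ (∀ i < m, ((Y i).card : ℝ) ≤ 2 * (Y' i).card) ∧
      ∀ i j, i < j → j < m →
        (∀ y ∈ Y' j, (((Y i).filter fun x => T.NonAdj x y).card : ℝ) ≤ 2 * m * l * (Y i).card) ∧
        (∀ y ∈ Y' i, (((Y j).filter fun x => T.NonAdj y x).card : ℝ) ≤ 2 * m * l * (Y j).card) := by
  have hm1 : (1 : ℝ) ≤ m := by exact_mod_cast hm
  -- The factor `2 * m` makes each `C i j` at most a `1 / (2m)` part of `Y i`, so fewer than half of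
  -- the vertices, or exactly half, are lost over all `j`. Densities stay relative to `Y`, not to
  -- the cleaned sets.
  let C : ℕ → ℕ → Finset W := fun i j => (Y i).filter fun y =>
    2 * m * l * (Y j).card < ((Y j).filter fun x => T.NonAdj y x).card
  let I : ℕ → Finset ℕ := fun i => (Finset.range m).filter fun j => i < j
  have hC : ∀ i j, i < j → j < m → 2 * m * ((C i j).card : ℝ) ≤ (Y i).card := fun i j hij hj =>
    card_mul_le_of_sparse (fun x y => T.NonAdj y x) (Y j) (Y i) hl0 (by positivity) (hY i j hij hj)
  refine ⟨fun i => Y i \ (I i).biUnion (C i), fun i => Finset.sdiff_subset, ?_, ?_⟩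
  · intro i _
    have h1 : (((I i).biUnion (C i)).card : ℝ) ≤ ∑ j ∈ I i, ((C i j).card : ℝ) := by
      exact_mod_cast Finset.card_biUnion_le
    have h2 : 2 * m * ∑ j ∈ I i, ((C i j).card : ℝ) ≤ m * (Y i).card := by
      rw [Finset.mul_sum]
      calc _ ≤ ∑ j ∈ I i, ((Y i).card : ℝ) := Finset.sum_le_sum fun j hj => by
            obtain ⟨hj1, hj2⟩ := Finset.mem_filter.1 hj
            exact hC i j hj2 (Finset.mem_range.1 hj1)
        _ = (I i).card * (Y i).card := by simp
        _ ≤ m * (Y i).card := by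
            gcongr
            calc (I i).card ≤ (Finset.range m).card := Finset.card_filter_le _ _
              _ = m := Finset.card_range m
    have h3 : 2 * ∑ j ∈ I i, ((C i j).card : ℝ) ≤ (Y i).card := by
      have h4 : (m : ℝ) * (2 * ∑ j ∈ I i, ((C i j).card : ℝ)) ≤ m * (Y i).card := by
        calc _ = 2 * m * ∑ j ∈ I i, ((C i j).card : ℝ) := by ring
          _ ≤ _ := h2
      exact le_of_mul_le_mul_left h4 (by positivity)
    have h5 : ((Y i).card : ℝ) ≤ (Y i \ (I i).biUnion (C i)).card + ((I i).biUnion (C i)).card := by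
      exact_mod_cast Finset.card_le_card_sdiff_add_card
    linarith
  · intro i j hij hj
    constructor
    · intro y hy
      refine (hY i j hij hj y (Finset.mem_sdiff.1 hy).1).trans ?_
      gcongr
      nlinarith
    · intro y hy
      obtain ⟨hy1, hy2⟩ := Finset.mem_sdiff.1 hy
      by_contra! hlt
      exact hy2 (Finset.mem_biUnion.2 ⟨j, Finset.mem_filter.2 ⟨Finset.mem_range.2 hj, hij⟩,
        Finset.mem_filter.2 ⟨hy1, hlt⟩⟩)

/-! ### Galaxies and the embedding of stars. -/

/-- `st` maps every vertex to the centre of its star in a galaxy ordered by `pos`, and `blk`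
numbers the centres by odd numbers and the intervals between centres by even ones. -/
structure StarData {V : Type*} (H : Tournament V) (pos : V → ℕ) (st : V → V) (blk : V → ℕ) :
    Prop where
  st_st : ∀ v, st (st v) = st v
  pos_injective : Function.Injective pos
  adj_of_lt : ∀ p q, pos p < pos q → ¬ (st p = st q ∧ (p = st p ∨ q = st q)) → H.Adj p q
  adj_of_star : ∀ p q, pos p < pos q → st p = st q → (p = st p ∨ q = st q) → H.Adj q p
  odd_blk : ∀ v, Odd (blk v) ↔ st v = v ∧ ∃ u, u ≠ v ∧ st u = v
  blk_mono : ∀ p q, pos p < pos q → blk p ≤ blk q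
  blk_strict : ∀ p q, pos p < pos q → Odd (blk p) ∨ Odd (blk q) → blk p < blk q
  blk_leaf : ∀ p q, st p = st q → p ≠ st p → q ≠ st q → blk p = blk q

/-- The vertex `x` is related to `w` as `p` would be to `q` if there were no backward edges. -/
def Forward {V W : Type*} (T : Tournament W) (pos : V → ℕ) (p q : V) (x w : W) : Prop :=
  (pos p < pos q → T.Adj x w) ∧ (pos q < pos p → T.Adj w x)

open scoped Classical in
/-- The vertices of a galaxy can be embedded one star at a time. -/
theorem not_isFree_of_stars {V W : Type*} [Fintype V] [Nonempty W] {H : Tournament V}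
    {T : Tournament W} {pos : V → ℕ} {st : V → V} {blk : V → ℕ} (hd : StarData H pos st blk)
    (Z : V → Finset W) (β : V → ℝ) (hβ : ∀ v, 0 ≤ β v)
    (hbad : ∀ p q, st p ≠ st q → ∀ x ∈ Z p,
      (((Z q).filter fun w => ¬ T.Forward pos p q x w).card : ℝ) ≤ β q)
    (hleaf : ∀ p q, st p = st q → p ≠ st p → q ≠ st q → pos p < pos q →
      ∀ x ∈ Z p, ∀ y ∈ Z q, T.Adj x y)
    (hstar : ∀ c, st c = c → ∀ U : V → Finset W,
      (∀ q, U q ⊆ Z q ∧ (st q = c → ((Z q).card : ℝ) ≤ (U q).card + Fintype.card V * β q)) →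
      ∃ ψ : V → W, (∀ q, st q = c → ψ q ∈ U q) ∧ ∀ q, st q = c → q ≠ c →
        (pos c < pos q → T.Adj (ψ q) (ψ c)) ∧ (pos q < pos c → T.Adj (ψ c) (ψ q))) :
    ¬ IsFree H T := by
  have main : ∀ P : Finset V, ∃ φ : V → W, (∀ p, st p ∈ P → φ p ∈ Z p) ∧
      ∀ p q, st p ∈ P → st q ∈ P → H.Adj p q → T.Adj (φ p) (φ q) := by
    intro P
    induction P using Finset.induction_on with
    | empty => exact ⟨fun _ => Classical.arbitrary W, by simp, by simp⟩
    | insert c P hc ih =>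
      obtain ⟨φ, hφ, hφa⟩ := ih
      by_cases hcc : st c = c
      swap
      · have key : ∀ p, st p ∈ insert c P → st p ∈ P := fun p hp =>
          (Finset.mem_insert.1 hp).resolve_left fun h => hcc (by rw [← h, hd.st_st])
        exact ⟨φ, fun p hp => hφ p (key p hp),
          fun p q hp hq => hφa p q (key p hp) (key q hq)⟩
      -- The candidates for `q` in forward position to all vertices embedded so far. At most `n`
      -- earlier vertices exclude at most `β q` candidates each.
      let U : V → Finset W := fun q =>
        (Z q).filter fun w => ∀ p, st p ∈ P → T.Forward pos p q (φ p) w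
      obtain ⟨ψ, hψ, hψa⟩ := hstar c hcc U (by
        intro q
        refine ⟨Finset.filter_subset _ _, fun hq => ?_⟩
        have h1 : Z q ⊆ U q ∪ (Finset.univ.filter fun p => st p ∈ P).biUnion fun p =>
            (Z q).filter fun w => ¬ T.Forward pos p q (φ p) w := by
          intro w hw
          by_cases h : ∀ p, st p ∈ P → T.Forward pos p q (φ p) w
          · exact Finset.mem_union_left _ (Finset.mem_filter.2 ⟨hw, h⟩)
          · push Not at h
            obtain ⟨p, hp, hpw⟩ := h
            exact Finset.mem_union_right _ (Finset.mem_biUnion.2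
              ⟨p, by simpa using hp, Finset.mem_filter.2 ⟨hw, hpw⟩⟩)
        have h2 := (Finset.card_le_card h1).trans (Finset.card_union_le _ _)
        have h3 : ((Z q).card : ℝ) ≤ (U q).card + ∑ p ∈ Finset.univ.filter fun p => st p ∈ P,
            (((Z q).filter fun w => ¬ T.Forward pos p q (φ p) w).card : ℝ) := by
          exact_mod_cast h2.trans (Nat.add_le_add_left Finset.card_biUnion_le _)
        refine h3.trans (add_le_add le_rfl ?_)
        calc _ ≤ ∑ _p ∈ Finset.univ.filter fun p => st p ∈ P, β q :=
              Finset.sum_le_sum fun p hp => by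
                have hp' := (Finset.mem_filter.1 hp).2
                exact hbad p q (fun e => hc (by rwa [← hq, ← e])) _ (hφ p hp')
          _ = ((Finset.univ.filter fun p => st p ∈ P).card : ℝ) * β q := by simp
          _ ≤ _ := by
            gcongr
            · exact hβ q
            · exact Finset.card_le_univ _)
      have hold : ∀ p, st p ∈ insert c P → st p ≠ c → st p ∈ P := fun p hp =>
        (Finset.mem_insert.1 hp).resolve_left
      have hψZ : ∀ p, st p = c → ψ p ∈ Z p := fun p hp => (Finset.mem_filter.1 (hψ p hp)).1
      have hcross : ∀ p q, st p ∈ P → st q = c → T.Forward pos p q (φ p) (ψ q) :=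
        fun p q hp hq => (Finset.mem_filter.1 (hψ q hq)).2 p hp
      -- Backward edges lie inside stars, so an edge between two stars goes forward.
      have hH : ∀ p q, st p ≠ st q → H.Adj p q → pos p < pos q := by
        intro p q hne hpq
        rcases lt_trichotomy (pos p) (pos q) with h | h | h
        · exact h
        · exact absurd (hd.pos_injective h) (H.ne_of_adj hpq)
        · exact absurd (hd.adj_of_lt q p h fun h' => hne h'.1.symm) (H.not_adj_of_adj hpq)
      refine ⟨fun p => if st p = c then ψ p else φ p, fun p hp => ?_, fun p q hp hq hpq => ?_⟩
      · dsimp only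
        split_ifs with h
        · exact hψZ p h
        · exact hφ p (hold p hp h)
      · dsimp only
        split_ifs with h1 h2 h2
        · by_cases hs : p = c ∨ q = c
          · have hs' : p = st p ∨ q = st q := by rwa [h1, h2]
            rcases lt_trichotomy (pos p) (pos q) with h | h | h
            · exact absurd (hd.adj_of_star p q h (h1.trans h2.symm) hs') (H.not_adj_of_adj hpq)
            · exact absurd (hd.pos_injective h) (H.ne_of_adj hpq)
            · rcases hs with rfl | rfl
              · exact (hψa q h2 (H.ne_of_adj hpq).symm).2 h
              · exact (hψa p h1 (H.ne_of_adj hpq)).1 h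
          · push Not at hs
            have hlt : pos p < pos q := by
              rcases lt_trichotomy (pos p) (pos q) with h | h | h
              · exact h
              · exact absurd (hd.pos_injective h) (H.ne_of_adj hpq)
              · refine absurd (hd.adj_of_lt q p h ?_) (H.not_adj_of_adj hpq)
                rw [h1, h2]
                tauto
            exact hleaf p q (h1.trans h2.symm) (h1 ▸ hs.1) (h2 ▸ hs.2) hlt _ (hψZ p h1) _
              (hψZ q h2)
        · have hne : st p ≠ st q := fun e => h2 (e ▸ h1)
          exact (hcross q p (hold q hq h2) h1).2 (hH p q hne hpq)
        · have hne : st p ≠ st q := fun e => h1 (e ▸ h2)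
          exact (hcross p q (hold p hp h1) h2).1 (hH p q hne hpq)
        · exact hφa p q (hold p hp h1) (hold q hq h2) hpq
  obtain ⟨φ, -, hφ⟩ := main Finset.univ
  exact not_isFree_of_hom φ fun p q => hφ p q (Finset.mem_univ _) (Finset.mem_univ _)

/-- The block of `v` is twice the number of centres before `v`, plus one if `v` is a centre. Leaves
of one star have the same centres before them: their own centre is at an end of the star, and no
other centre separates them. An isolated vertex is its own `st` but counts as a non-centre, in an
even block. -/
theorem IsGalaxy.exists_starData {V : Type*} [Fintype V] {H : Tournament V} (hH : H.IsGalaxy) :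
    ∃ pos st blk, StarData H pos st blk ∧ (∀ v, pos v < Fintype.card V) ∧
      ∀ v, blk v < 2 * Fintype.card V := by
  classical
  obtain ⟨θ, center, hK, hbetween⟩ := hH
  let G := H.backwardGraph θ
  let K : V → G.ConnectedComponent := fun v => G.connectedComponentMk v
  have hstar : ∀ L : G.ConnectedComponent, L.supp.Nontrivial →
      H.IsStarWithCenter θ L.supp (center L) := by
    intro L hL
    refine (hK L).resolve_left ?_
    rintro ⟨v, hv⟩
    rw [hv] at hL
    exact Set.not_nontrivial_singleton hL
  have hcen : ∀ L : G.ConnectedComponent, L.supp.Nontrivial → K (center L) = L := by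
    intro L hL
    obtain ⟨-, ⟨hc, -⟩, -⟩ := hstar L hL
    exact hc
  have hadj : ∀ p q, K p = K q → (G.Adj p q ↔
      p ≠ q ∧ (p = center (K p) ∨ q = center (K p))) := by
    intro p q e
    by_cases hpq : p = q
    · subst hpq
      simp
    · have hn : (K p).supp.Nontrivial := ⟨p, rfl, q, e.symm, hpq⟩
      obtain ⟨-, ⟨hc, hi⟩, -⟩ := hstar _ hn
      have h1 : ((H.backwardGraph θ).induce (K p).supp).Adj ⟨p, rfl⟩ ⟨q, e.symm⟩ ↔ G.Adj p q :=
        Iff.rfl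
      rw [← h1, hi]
      simp [SimpleGraph.starGraph, Subtype.ext_iff, hpq]
  let st : V → V := fun v => if (K v).supp.Nontrivial then center (K v) else v
  have hKst : ∀ v, K (st v) = K v := by
    intro v
    by_cases h : (K v).supp.Nontrivial
    · simp only [st, if_pos h]
      exact hcen _ h
    · simp only [st, if_neg h]
  have hstK : ∀ p q, st p = st q → K p = K q := fun p q e => by
    rw [← hKst p, e, hKst]
  have hstn : ∀ p q, p ≠ q → K p = K q →
      (K p).supp.Nontrivial ∧ st p = center (K p) ∧ st q = center (K p) := by
    intro p q hpq e
    have hn : (K p).supp.Nontrivial := ⟨p, rfl, q, e.symm, hpq⟩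
    refine ⟨hn, if_pos hn, ?_⟩
    simp only [st]
    rw [← e, if_pos hn]
  have hst : ∀ v, st (st v) = st v := by
    intro v
    by_cases h : (K v).supp.Nontrivial
    · have e : st (st v) = center (K (st v)) := if_pos (by rwa [hKst])
      rw [e, hKst]
      exact (if_pos h).symm
    · have : st v = v := if_neg h
      rw [this, this]
  let C : V → Prop := fun v => st v = v ∧ ∃ u, u ≠ v ∧ st u = v
  have hCn : ∀ v, C v → (K v).supp.Nontrivial ∧ center (K v) = v := by
    rintro v ⟨h1, u, hu, h2⟩
    obtain ⟨hn, h3, -⟩ := hstn v u hu.symm (hstK v u (h1.trans h2.symm))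
    exact ⟨hn, h3.symm.trans h1⟩
  let N : V → Finset V := fun v => Finset.univ.filter fun u => C u ∧ θ u < θ v
  have hN : ∀ p q, θ p < θ q → N p ⊆ N q := fun p q h u hu => by
    simp only [N, Finset.mem_filter, Finset.mem_univ, true_and] at hu ⊢
    exact ⟨hu.1, hu.2.trans h⟩
  have hNC : ∀ p q, θ p < θ q → C p → (N p).card + 1 ≤ (N q).card := fun p q h hp => by
    refine Finset.card_lt_card ⟨hN p q h, fun hs => ?_⟩
    have hpq : p ∈ N q := Finset.mem_filter.2 ⟨Finset.mem_univ _, hp, h⟩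
    exact lt_irrefl _ (Finset.mem_filter.1 (hs hpq)).2.2
  have hleaf : ∀ p q, st p = st q → p ≠ st p → q ≠ st q → N p ⊆ N q := by
    intro p q e hp hq u hu
    simp only [N, Finset.mem_filter, Finset.mem_univ, true_and] at hu ⊢
    refine ⟨hu.1, ?_⟩
    by_contra! hle
    have hCq : ¬ C q := fun h => hq h.1.symm
    have hlt : θ q < θ u := lt_of_le_of_ne hle fun h => hCq (θ.injective h ▸ hu.1)
    have hpq : p ≠ q := by
      rintro rfl
      exact lt_asymm hlt hu.2
    obtain ⟨hun, huc⟩ := hCn u hu.1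
    obtain ⟨hn, h1, h2⟩ := hstn p q hpq (hstK p q e)
    have hqK : K q = K p := (hstK p q e).symm
    rw [h1] at hp
    rw [h2] at hq
    by_cases hKu : K u = K p
    · obtain ⟨-, -, h3⟩ := hstar (K p) hn
      rw [← hKu, huc, hKu] at h3
      rw [← hKu, huc] at hp hq
      rcases h3 with h3 | h3
      · exact lt_asymm hlt (h3 q hqK hq)
      · exact lt_asymm hu.2 (h3 p rfl hp)
    · refine hbetween (K u) (K p) hKu hun hn q hqK p rfl hq hp ?_
      rw [huc]
      exact ⟨hlt, hu.2⟩
  have hodd : ∀ v, Odd (2 * (N v).card + if C v then 1 else 0) ↔ C v := by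
    intro v
    by_cases h : C v
    · simp [h]
    · simp [h]
  refine ⟨fun v => θ v, st, fun v => 2 * (N v).card + if C v then 1 else 0,
    ⟨hst, fun p q h => θ.injective (Fin.ext h), ?_, ?_, hodd, ?_, ?_, ?_⟩,
    fun v => (θ v).2, fun v => ?_⟩
  · intro p q hlt hno
    have hpq : p ≠ q := by
      rintro rfl
      exact lt_irrefl _ hlt
    refine (H.adj_or_adj hpq).resolve_right fun h => hno ?_
    have ha : G.Adj p q := Or.inr ⟨h, hlt⟩
    have e : K p = K q := SimpleGraph.ConnectedComponent.sound ha.reachable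
    obtain ⟨-, h1, h2⟩ := hstn p q hpq e
    refine ⟨h1.trans h2.symm, ?_⟩
    rw [h1, h2]
    exact ((hadj p q e).1 ha).2
  · intro p q hlt e hs
    have hpq : p ≠ q := by
      rintro rfl
      exact lt_irrefl _ hlt
    obtain ⟨-, h1, h2⟩ := hstn p q hpq (hstK p q e)
    rw [h1, h2] at hs
    have ha : G.Adj p q := (hadj p q (hstK p q e)).2 ⟨hpq, hs⟩
    rcases ha with ha | ha
    · exact absurd ha.2 (not_lt.2 (le_of_lt hlt))
    · exact ha.1
  · intro p q hlt
    by_cases hp : C p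
    · have := hNC p q hlt hp
      simp only [hp, if_true]
      omega
    · have := Finset.card_le_card (hN p q hlt)
      simp only [hp, if_false]
      omega
  · intro p q hlt ho
    simp only [hodd] at ho
    by_cases hp : C p
    · have := hNC p q hlt hp
      simp only [hp, if_true]
      omega
    · have := Finset.card_le_card (hN p q hlt)
      simp only [hp, false_or] at ho
      simp only [hp, ho, if_false, if_true]
      omega
  · intro p q e hp hq
    have h1 := Finset.card_le_card (hleaf p q e hp hq)
    have h2 := Finset.card_le_card (hleaf q p e.symm hq hp)
    have hCp : ¬ C p := fun h => hp h.1.symm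
    have hCq : ¬ C q := fun h => hq h.1.symm
    simp only [hCp, hCq, if_false]
    omega
  · have h1 : (N v).card < Fintype.card V := Finset.card_lt_univ_of_notMem (x := v) fun h =>
      lt_irrefl _ (Finset.mem_filter.1 h).2.2
    dsimp only
    split_ifs <;> omega

/-! ### Unions and pieces of transitive sets. -/

theorem IsTransitiveSet.mono {W : Type*} {T : Tournament W} {X Y : Finset W}
    (hX : T.IsTransitiveSet X) (h : Y ⊆ X) : T.IsTransitiveSet Y := by
  rw [isTransitiveSet_iff] at hX ⊢
  exact fun a ha b hb c hc => hX a (h ha) b (h hb) c (h hc)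

open scoped Classical in
theorem IsTransitiveSet.union {W : Type*} {T : Tournament W} {X Y : Finset W}
    (hX : T.IsTransitiveSet X) (hY : T.IsTransitiveSet Y)
    (h : ∀ x ∈ X, ∀ y ∈ Y, T.Adj x y) : T.IsTransitiveSet (X ∪ Y) := by
  rw [isTransitiveSet_iff] at hX hY ⊢
  intro a ha b hb c hc hab hbc
  rw [Finset.mem_union] at ha hb hc
  rcases ha with ha | ha <;> rcases hc with hc | hc
  · rcases hb with hb | hb
    · exact hX a ha b hb c hc hab hbc
    · exact absurd (h c hc b hb) (T.not_adj_of_adj hbc)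
  · exact h a ha c hc
  · rcases hb with hb | hb
    · exact absurd (h b hb a ha) (T.not_adj_of_adj hab)
    · exact absurd (h c hc b hb) (T.not_adj_of_adj hbc)
  · rcases hb with hb | hb
    · exact absurd (h b hb a ha) (T.not_adj_of_adj hab)
    · exact hY a ha b hb c hc hab hbc

/-- The vertices of the transitive set `X` in the positions `k * r, …, (k + 1) * r - 1`. -/
noncomputable def piece {W : Type*} (T : Tournament W) (X : Finset W) (r k : ℕ) : Finset W := by
  classical exact X.filter fun x => k * r ≤ T.rank X x ∧ T.rank X x < (k + 1) * r

theorem piece_subset {W : Type*} (T : Tournament W) (X : Finset W) (r k : ℕ) :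
    T.piece X r k ⊆ X := Finset.filter_subset _ _

theorem le_card_piece {W : Type*} {T : Tournament W} {X : Finset W} (hX : T.IsTransitiveSet X)
    {r k : ℕ} (h : (k + 1) * r ≤ X.card) : r ≤ (T.piece X r k).card := by
  classical
  have h1 : Finset.Ico (k * r) ((k + 1) * r) ⊆ (T.piece X r k).image (T.rank X) := by
    intro i hi
    rw [Finset.mem_Ico] at hi
    have h2 : i ∈ X.image (T.rank X) := by
      rw [image_rank hX, Finset.mem_range]
      omega
    obtain ⟨x, hx, rfl⟩ := Finset.mem_image.1 h2
    exact Finset.mem_image.2 ⟨x, Finset.mem_filter.2 ⟨hx, hi⟩, rfl⟩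
  have h3 := (Finset.card_le_card h1).trans Finset.card_image_le
  rw [Nat.card_Ico, add_mul, one_mul, Nat.add_sub_cancel_left] at h3
  exact h3

theorem adj_of_mem_piece {W : Type*} {T : Tournament W} {X : Finset W} (hX : T.IsTransitiveSet X)
    {r k k' : ℕ} (h : k < k') {x y : W} (hx : x ∈ T.piece X r k) (hy : y ∈ T.piece X r k') :
    T.Adj x y := by
  classical
  obtain ⟨hx1, -, hx2⟩ := Finset.mem_filter.1 hx
  obtain ⟨hy1, hy2, -⟩ := Finset.mem_filter.1 hy
  exact adj_of_rank_lt hX hx1 hy1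
    (hx2.trans_le ((Nat.mul_le_mul_right r h).trans hy2))

/-! ### The minimal counterexample. -/

/-- The loss in passing to an almost complete pair in a tournament free of an
`n`-vertex tournament. -/
noncomputable def pairLoss (n : ℕ) : ℝ := 4 * n ^ 2 * (2 / (1 / (96 * (n : ℝ) ^ 3))) ^ n

open scoped Classical in
/-- In a tournament free of a galaxy, not all of the properties of a minimal
counterexample hold. -/
theorem IsGalaxy.not_critical {V W : Type*} [Fintype V] [Nonempty V] {H : Tournament V}
    (hH : H.IsGalaxy) {T : Tournament W} (hT : IsFree H T) {n : ℕ} (hn : n = Fintype.card V)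
    {S : Finset W} {t s : ℝ} (hs : 1 ≤ s) (ht : 12 * n < t)
    (hbig : ∀ A ⊂ S, s ≤ A.card → ∃ X ⊆ A, T.IsTransitiveSet X ∧ t / 2 ≤ X.card)
    (hout : ∀ X ⊆ S, T.IsTransitiveSet X → t ≤ 12 * n * X.card → ∀ A ⊆ S, s ≤ A.card →
      ¬ ∀ x ∈ X, ∀ a ∈ A, T.Adj x a)
    (hin : ∀ X ⊆ S, T.IsTransitiveSet X → t ≤ 12 * n * X.card → ∀ A ⊆ S, s ≤ A.card →
      ¬ ∀ x ∈ X, ∀ a ∈ A, T.Adj a x)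
    (hS : (2 * pairLoss n) ^ (2 * n) * (4 * n * s) + 1 ≤ S.card) : False := by
  obtain ⟨pos, st, blk, hd, hpos, hblk⟩ := hH.exists_starData
  rw [← hn] at hpos hblk
  have hn0 : 0 < n := hn ▸ Fintype.card_pos
  have hn1 : (1 : ℝ) ≤ n := by exact_mod_cast hn0
  have hnpos : (0 : ℝ) < n := by linarith
  have hspos : 0 < s := by linarith
  have htpos : 0 < t := by nlinarith
  set l : ℝ := 1 / (96 * (n : ℝ) ^ 3) with hl
  have hl0 : 0 < l := by positivity
  have hl1 : l ≤ 1 := by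
    rw [hl, div_le_one (by positivity)]
    nlinarith [one_le_pow₀ hn1 (n := 3)]
  have hD : 1 ≤ pairLoss n := by
    have h1 : 1 ≤ (2 / l) ^ n := one_le_pow₀ (by rw [le_div_iff₀ hl0]; linarith)
    have h2 : (1 : ℝ) ≤ (n : ℝ) ^ 2 := one_le_pow₀ hn1
    rw [pairLoss, ← hl]
    nlinarith
  have hSpos : (0 : ℝ) < S.card := lt_of_lt_of_le (by positivity) hS
  obtain ⟨x₀, hx₀⟩ : S.Nonempty := by
    rw [← Finset.card_pos]
    exact_mod_cast hSpos
  have hW : Nonempty W := ⟨x₀⟩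
  -- Removing one vertex makes every set used below a proper subset, as `hbig` requires; this costs
  -- the `+ 1` in `hS`.
  have hU₀ : S.erase x₀ ⊂ S := Finset.erase_ssubset hx₀
  obtain ⟨Y, hYQ, hYd⟩ := exists_dense_sequence (T := T) (s := 4 * n * s) hl0 hD (by positivity)
    (fun U hU => by
      have := exists_dense_pair hT hl0 hl1 U (by
        rw [← hn]
        have : (n : ℝ) ≤ U.card := by nlinarith
        exact_mod_cast this)
      rwa [← hn] at this) (2 * n)
    (fun i Y => (Odd i → 4 * n * s ≤ Y.card) ∧
      (¬ Odd i → T.IsTransitiveSet Y ∧ t / 2 ≤ Y.card)) (S.erase x₀)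
    (fun i A hA hAc => by
      by_cases hi : Odd i
      · exact ⟨A, Finset.Subset.refl _, fun _ => hAc, fun h => absurd hi h⟩
      · obtain ⟨X, hXA, hX⟩ := hbig A (lt_of_le_of_lt hA hU₀) (by nlinarith)
        exact ⟨X, hXA, fun h => absurd h hi, fun _ => hX⟩)
    (by
      rw [Finset.card_erase_of_mem hx₀, Nat.cast_sub (Finset.card_pos.2 ⟨x₀, hx₀⟩)]
      push_cast
      linarith)
  obtain ⟨Y', hY'Y, hY'c, hY'd⟩ := exists_cleaned_sequence (T := T) (l := 2 * l) (m := 2 * n)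
    (by positivity) (by omega) Y fun i j hij hj => (hYd i j hij hj).2
  -- The constant `96 n ^ 3` is chosen for this: `2 l` from the sequence, times `2 * (2n)` from
  -- cleaning, times `n` embedded vertices, spoils a fraction `1 / (12n)` of a set.
  have hμ : (n : ℝ) * (2 * (2 * n : ℕ) * (2 * l)) = 1 / (12 * n) := by
    rw [hl]
    push_cast
    field_simp
    norm_num
  set μ : ℝ := 2 * (2 * n : ℕ) * (2 * l) with hμd
  have hμ0 : 0 ≤ μ := by positivity
  have hYS : ∀ v, Y (blk v) ⊆ S := fun v => (hYQ _ (hblk v)).1.trans hU₀.subset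
  have hYtr : ∀ v, ¬ Odd (blk v) → T.IsTransitiveSet (Y' (blk v)) := fun v hv =>
    ((hYQ _ (hblk v)).2.2 hv).1.mono (hY'Y _)
  -- Vertices other than centres get pieces indexed by their position in the whole galaxy ordering,
  -- so pieces within one block are completely forward.
  let Z : V → Finset W := fun v => if Odd (blk v) then Y' (blk v) else
    T.piece (Y' (blk v)) ((Y' (blk v)).card / n) (pos v)
  have hZpiece : ∀ v, ¬ Odd (blk v) →
      Z v = T.piece (Y' (blk v)) ((Y' (blk v)).card / n) (pos v) := fun v hv => if_neg hv
  have hZodd : ∀ v, Odd (blk v) → Z v = Y' (blk v) := fun v hv => if_pos hv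
  have hZY' : ∀ v, Z v ⊆ Y' (blk v) := by
    intro v
    by_cases hv : Odd (blk v)
    · exact (hZodd v hv).subset
    · rw [hZpiece v hv]
      exact piece_subset _ _ _ _
  have hZY : ∀ v, Z v ⊆ Y (blk v) := fun v => (hZY' v).trans (hY'Y _)
  have hZadj : ∀ p q, blk p = blk q → pos p < pos q → ∀ x ∈ Z p, ∀ y ∈ Z q, T.Adj x y := by
    intro p q e hlt x hx y hy
    have hq : ¬ Odd (blk q) := fun h => (hd.blk_strict p q hlt (Or.inr h)).ne e
    have hp : ¬ Odd (blk p) := fun h => hq (e ▸ h)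
    rw [hZpiece p hp, e] at hx
    rw [hZpiece q hq] at hy
    exact adj_of_mem_piece (hYtr q hq) hlt hx hy
  have hodd : ∀ q, q ≠ st q → ¬ Odd (blk q) := fun q hq h => hq ((hd.odd_blk q).1 h).1.symm
  have hleafsize : ∀ q, ¬ Odd (blk q) → ∀ U : Finset W,
      ((Z q).card : ℝ) ≤ U.card + n * (μ * (Y (blk q)).card) → t ≤ 12 * n * U.card := by
    intro q hq U hU
    have h1 : (Y' (blk q)).card / n ≤ (Z q).card := by
      rw [hZpiece q hq]
      apply le_card_piece (hYtr q hq)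
      calc (pos q + 1) * ((Y' (blk q)).card / n) ≤ n * ((Y' (blk q)).card / n) :=
            Nat.mul_le_mul_right _ (hpos q)
        _ ≤ _ := Nat.mul_div_le _ _
    have h2 : ((Y' (blk q)).card : ℝ) ≤ n * ((Z q).card + 1) := by
      have h3 := Nat.div_add_mod (Y' (blk q)).card n
      have h4 := Nat.mod_lt (Y' (blk q)).card hn0
      have : (Y' (blk q)).card ≤ n * ((Z q).card + 1) := by nlinarith
      exact_mod_cast this
    have h5 := hY'c _ (hblk q)
    have h6 := ((hYQ _ (hblk q)).2.2 hq).2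
    have h7 : n * (μ * (Y (blk q)).card) = 1 / (12 * n) * (Y (blk q)).card := by
      rw [← hμ]; ring
    rw [h7] at hU
    have h8 : 12 * n * (1 / (12 * n) * ((Y (blk q)).card : ℝ)) = (Y (blk q)).card := by
      rw [← mul_assoc, mul_one_div_cancel (by positivity), one_mul]
    -- Altogether `12 n |U| ≥ 5 |Y| - 12 n` with `|Y| ≥ t / 2`; the hypothesis `12 n < t` absorbs
    -- the rounding.
    nlinarith
  have hcensize : ∀ q, Odd (blk q) → ∀ U : Finset W,
      ((Z q).card : ℝ) ≤ U.card + n * (μ * (Y (blk q)).card) → n * s ≤ U.card := by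
    intro q hq U hU
    rw [hZodd q hq] at hU
    have h5 := hY'c _ (hblk q)
    have h6 := (hYQ _ (hblk q)).2.1 hq
    have h7 : n * (μ * (Y (blk q)).card) = 1 / (12 * n) * (Y (blk q)).card := by
      rw [← hμ]; ring
    have h8 : 1 / (12 * (n : ℝ)) ≤ 1 / 4 := by
      apply one_div_le_one_div_of_le <;> linarith
    have h9 := mul_le_mul_of_nonneg_right h8 (Nat.cast_nonneg (α := ℝ) (Y (blk q)).card)
    linarith
  refine not_isFree_of_stars (T := T) hd Z (fun v => μ * (Y (blk v)).card)
    (fun v => by positivity) ?_ ?_ ?_ hT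
  · intro p q hpq x hx
    have hblk_lt : ∀ p q, blk p < blk q → pos p < pos q := by
      intro p q h
      by_contra! hle
      rcases hle.lt_or_eq with h1 | h1
      · exact absurd (hd.blk_mono q p h1) (not_le.2 h)
      · exact h.ne (hd.pos_injective h1 ▸ rfl)
    have hx' := hZY' p hx
    rcases lt_trichotomy (blk p) (blk q) with h | h | h
    · have hp := hblk_lt p q h
      refine le_trans ?_ ((hY'd _ _ h (hblk q)).2 x hx')
      rw [Nat.cast_le]
      refine Finset.card_le_card fun w hw => ?_
      obtain ⟨hw1, hw2⟩ := Finset.mem_filter.1 hw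
      exact Finset.mem_filter.2 ⟨hZY q hw1, fun h' =>
        hw2 ⟨fun _ => h', fun h'' => absurd h'' hp.not_gt⟩⟩
    · have h0 : (Z q).filter (fun w => ¬ T.Forward pos p q x w) = ∅ := by
        refine Finset.filter_eq_empty_iff.2 fun w hw => not_not.2 ⟨fun h1 => ?_, fun h1 => ?_⟩
        · exact hZadj p q h h1 x hx w hw
        · exact hZadj q p h.symm h1 w hw x hx
      rw [h0, Finset.card_empty, Nat.cast_zero]
      positivity
    · have hp := hblk_lt q p h
      refine le_trans ?_ ((hY'd _ _ h (hblk p)).1 x hx')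
      rw [Nat.cast_le]
      refine Finset.card_le_card fun w hw => ?_
      obtain ⟨hw1, hw2⟩ := Finset.mem_filter.1 hw
      exact Finset.mem_filter.2 ⟨hZY q hw1, fun h' =>
        hw2 ⟨fun h'' => absurd h'' hp.not_gt, fun _ => h'⟩⟩
  · intro p q e hp hq hlt
    exact hZadj p q (hd.blk_leaf p q e hp hq) hlt
  · intro c hc U hU
    rw [← hn] at hU
    by_cases hc1 : ∃ u, u ≠ c ∧ st u = c
    swap
    · push Not at hc1
      have hco : ¬ Odd (blk c) := fun h => by
        obtain ⟨-, u, hu, hu'⟩ := (hd.odd_blk c).1 h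
        exact hc1 u hu hu'
      have h1 := hleafsize c hco (U c) ((hU c).2 hc)
      obtain ⟨a, ha⟩ : (U c).Nonempty := by
        rw [← Finset.card_pos]
        by_contra! h0
        have : (U c).card = 0 := by omega
        rw [this] at h1
        simp at h1
        linarith
      refine ⟨fun _ => a, fun q hq => ?_, fun q hq hqc => absurd hq (hc1 q hqc)⟩
      by_cases hqc : q = c
      · rwa [hqc]
      · exact absurd hq (hc1 q hqc)
    · have hco : Odd (blk c) := (hd.odd_blk c).2 ⟨hc, hc1⟩
      have hUc := hcensize c hco (U c) ((hU c).2 hc)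
      -- The candidates for the centre with no backward edge to the candidates for the leaf `q`.
      -- They are complete to or from a large transitive set, so there are at most `s` of them, and
      -- fewer than `n` leaves cannot exhaust `n * s` candidates.
      let B : V → Finset W := fun q => (U c).filter fun a => ¬ ∃ w ∈ U q,
        (pos c < pos q → T.Adj w a) ∧ (pos q < pos c → T.Adj a w)
      let L : Finset V := Finset.univ.filter fun q => st q = c ∧ q ≠ c
      have hB : ∀ q ∈ L, ((B q).card : ℝ) ≤ s := by
        intro q hq
        obtain ⟨hq1, hq2⟩ := (Finset.mem_filter.1 hq).2
        have hqo : ¬ Odd (blk q) := hodd q (hq1 ▸ hq2)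
        have h1 := hleafsize q hqo (U q) ((hU q).2 hq1)
        have hUqY : U q ⊆ Y (blk q) := (hU q).1.trans (hZY q)
        have hUtr : T.IsTransitiveSet (U q) :=
          (hYtr q hqo).mono ((hU q).1.trans (hZY' q))
        have hBY : B q ⊆ Y (blk c) := (Finset.filter_subset _ _).trans ((hU c).1.trans (hZY c))
        have hdisj : ∀ a ∈ B q, ∀ w ∈ U q, a ≠ w := by
          rintro a ha w hw rfl
          rcases lt_trichotomy (blk c) (blk q) with h | h | h
          · exact Finset.disjoint_left.1 (hYd _ _ h (hblk q)).1 (hBY ha) (hUqY hw)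
          · exact hqo (h ▸ hco)
          · exact Finset.disjoint_left.1 (hYd _ _ h (hblk c)).1 (hUqY hw) (hBY ha)
        by_contra! hlt
        rcases lt_or_gt_of_ne (fun h => hq2 (hd.pos_injective h) : pos q ≠ pos c) with h | h
        · refine hout (U q) (hUqY.trans (hYS q)) hUtr h1 (B q) (hBY.trans (hYS c)) hlt.le
            fun w hw a ha => ?_
          refine (T.not_adj_iff (hdisj a ha w hw)).1 fun h' => ?_
          exact (Finset.mem_filter.1 ha).2 ⟨w, hw, fun h'' => absurd h'' h.not_gt, fun _ => h'⟩
        · refine hin (U q) (hUqY.trans (hYS q)) hUtr h1 (B q) (hBY.trans (hYS c)) hlt.le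
            fun w hw a ha => ?_
          refine (T.not_adj_iff (hdisj a ha w hw).symm).1 fun h' => ?_
          exact (Finset.mem_filter.1 ha).2 ⟨w, hw, fun _ => h', fun h'' => absurd h'' h.not_gt⟩
      have hLn : L.card < n := by
        rw [hn]
        exact Finset.card_lt_univ_of_notMem (x := c) fun h => (Finset.mem_filter.1 h).2.2 rfl
      obtain ⟨a, ha, haB⟩ : ∃ a ∈ U c, a ∉ L.biUnion B := by
        by_contra! hsub
        have h1 : ((U c).card : ℝ) ≤ ∑ q ∈ L, ((B q).card : ℝ) := by
          exact_mod_cast (Finset.card_le_card hsub).trans Finset.card_biUnion_le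
        have h2 : ∑ q ∈ L, ((B q).card : ℝ) ≤ L.card * s := by
          rw [← nsmul_eq_mul]
          exact Finset.sum_le_card_nsmul _ _ _ hB
        have h3 : (L.card : ℝ) < n := by exact_mod_cast hLn
        nlinarith
      have hex : ∀ q, ∃ w, q ∈ L → w ∈ U q ∧
          (pos c < pos q → T.Adj w a) ∧ (pos q < pos c → T.Adj a w) := by
        intro q
        by_cases hq : q ∈ L
        · by_contra! hno
          refine haB (Finset.mem_biUnion.2 ⟨q, hq, Finset.mem_filter.2 ⟨ha, ?_⟩⟩)
          rintro ⟨w, hw, hw1, hw2⟩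
          obtain ⟨-, h⟩ := hno w
          obtain ⟨h3, h4⟩ := h hw hw1
          exact h4 (hw2 h3)
        · exact ⟨a, fun h => absurd h hq⟩
      choose ψ hψ using hex
      refine ⟨fun q => if q = c then a else ψ q, fun q hq => ?_, fun q hq hqc => ?_⟩
      · dsimp only
        split_ifs with h
        · rwa [h]
        · exact (hψ q (Finset.mem_filter.2 ⟨Finset.mem_univ _, hq, h⟩)).1
      · simp only [hqc, if_true, if_false]
        exact (hψ q (Finset.mem_filter.2 ⟨Finset.mem_univ _, hq, hqc⟩)).2

-- A minimal counterexample `S` satisfies the hypotheses of `not_critical`. The condition `hce`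
-- makes the induction lose only the fraction `1 / (12n)` of `t` on sets of size `c|S|`, just what a
-- forbidden transitive set would restore.
open scoped Classical in
theorem IsGalaxy.exists_isTransitiveSet {V W : Type*} [Fintype V] [Nonempty V] {H : Tournament V}
    (hH : H.IsGalaxy) {T : Tournament W} (hT : IsFree H T) {n : ℕ} (hn : n = Fintype.card V)
    {c e : ℝ} (hc0 : 0 < c) (hc : c * (8 * n * (2 * pairLoss n) ^ (2 * n)) ≤ 1) (hc4 : c ≤ 1 / 4)
    (he : 0 < e) (hce : 1 - 1 / (12 * n) ≤ c ^ e) (S : Finset W) :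
    ∃ X ⊆ S, T.IsTransitiveSet X ∧ (S.card : ℝ) ^ e ≤ X.card := by
  have hn0 : 0 < n := hn ▸ Fintype.card_pos
  have hn1 : (1 : ℝ) ≤ n := by exact_mod_cast hn0
  induction S using Finset.strongInduction with
  | H S ih =>
  by_contra! hcon
  set t := (S.card : ℝ) ^ e with ht
  set s := c * S.card with hs
  have hsub : ∀ X : Finset W, X.card ≤ 1 → T.IsTransitiveSet X := by
    intro X hX
    rw [isTransitiveSet_iff]
    intro a ha b hb d _ hab _
    exact absurd (Finset.card_le_one.1 hX a ha b hb) (T.ne_of_adj hab)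
  have hS2 : 2 ≤ S.card := by
    by_contra! hlt
    have h1 := hcon S (Finset.Subset.refl _) (hsub S (by omega))
    rw [ht] at h1
    interval_cases h : S.card
    · simp [Real.zero_rpow he.ne'] at h1
    · simp at h1
  have hS2' : (2 : ℝ) ≤ S.card := by exact_mod_cast hS2
  have hSpos : (0 : ℝ) < S.card := by linarith
  have hspos : 0 < s := by positivity
  have htpos : 0 < t := by positivity
  have hst : s ^ e = c ^ e * t := Real.mul_rpow hc0.le hSpos.le
  have hκ : 1 / (12 * (n : ℝ)) ≤ 1 / 12 := by
    apply one_div_le_one_div_of_le <;> linarith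
  have hbig : ∀ A ⊂ S, s ≤ A.card → ∃ X ⊆ A, T.IsTransitiveSet X ∧
      (1 - 1 / (12 * n)) * t ≤ X.card := by
    intro A hA hAc
    obtain ⟨X, hX, hXt, hXc⟩ := ih A hA
    refine ⟨X, hX, hXt, le_trans ?_ hXc⟩
    calc (1 - 1 / (12 * n)) * t ≤ c ^ e * t := by gcongr
      _ = s ^ e := hst.symm
      _ ≤ _ := Real.rpow_le_rpow hspos.le hAc he.le
  have hκt : ∀ x : ℝ, t ≤ 12 * n * x → 1 / (12 * n) * t ≤ x := by
    intro x hx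
    rw [one_div, inv_mul_le_iff₀ (by positivity)]
    exact hx
  have hXne : ∀ X : Finset W, t ≤ 12 * n * X.card → X.Nonempty := by
    intro X hX
    rw [Finset.nonempty_iff_ne_empty]
    rintro rfl
    simp at hX
    linarith
  have hproper : ∀ A ⊆ S, ∀ x ∈ S, x ∉ A → A ⊂ S := fun A hA x hx hxA =>
    ⟨hA, fun h => hxA (h hx)⟩
  have hout : ∀ X ⊆ S, T.IsTransitiveSet X → t ≤ 12 * n * X.card → ∀ A ⊆ S, s ≤ A.card →
      ¬ ∀ x ∈ X, ∀ a ∈ A, T.Adj x a := by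
    intro X hXS hX hXc A hAS hA h
    obtain ⟨x, hx⟩ := hXne X hXc
    obtain ⟨Y, hYA, hY, hYc⟩ := hbig A
      (hproper A hAS x (hXS hx) fun hxA => T.loopless x (h x hx x hxA)) hA
    have h1 := hcon (X ∪ Y) (Finset.union_subset hXS (hYA.trans hAS))
      (hX.union hY fun x hx y hy => h x hx y (hYA hy))
    rw [Finset.card_union_of_disjoint (Finset.disjoint_left.2 fun x hx hy =>
      T.loopless x (h x hx x (hYA hy)))] at h1
    push_cast at h1
    have h2 := hκt _ hXc
    linarith
  have hin : ∀ X ⊆ S, T.IsTransitiveSet X → t ≤ 12 * n * X.card → ∀ A ⊆ S, s ≤ A.card →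
      ¬ ∀ x ∈ X, ∀ a ∈ A, T.Adj a x := by
    intro X hXS hX hXc A hAS hA h
    obtain ⟨x, hx⟩ := hXne X hXc
    obtain ⟨Y, hYA, hY, hYc⟩ := hbig A
      (hproper A hAS x (hXS hx) fun hxA => T.loopless x (h x hx x hxA)) hA
    have h1 := hcon (Y ∪ X) (Finset.union_subset (hYA.trans hAS) hXS)
      (hY.union hX fun y hy x hx => h x hx y (hYA hy))
    rw [Finset.card_union_of_disjoint (Finset.disjoint_left.2 fun x hy hx =>
      T.loopless x (h x hx x (hYA hy)))] at h1
    push_cast at h1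
    have h2 := hκt _ hXc
    linarith
  -- Otherwise a single vertex is already a forbidden transitive set: since `c ≤ 1 / 4` and `|S| ≥
  -- 2`, its out- or in-neighbourhood in `S` has at least `s` vertices.
  have ht12 : 12 * n < t := by
    by_contra! hle
    obtain ⟨x, hx⟩ : S.Nonempty := by
      rw [← Finset.card_pos]
      omega
    have hX : T.IsTransitiveSet {x} := hsub _ (by simp)
    have hXc : t ≤ 12 * n * (({x} : Finset W).card : ℝ) := by simpa using hle
    have hXS : {x} ⊆ S := Finset.singleton_subset_iff.2 hx
    have h1 := Finset.card_filter_add_card_filter_not (s := S.erase x) (fun y => T.Adj x y)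
    rw [Finset.card_erase_of_mem hx] at h1
    have h2 : (((S.erase x).filter fun y => T.Adj x y).card : ℝ) +
        ((S.erase x).filter fun y => ¬ T.Adj x y).card = S.card - 1 := by
      rw [← Nat.cast_add, h1, Nat.cast_sub (by omega), Nat.cast_one]
    have hs4 : s ≤ S.card / 4 := by
      rw [hs]
      nlinarith
    rcases le_or_gt s ((S.erase x).filter fun y => T.Adj x y).card with h3 | h3
    · refine hout {x} hXS hX hXc _ ((Finset.filter_subset _ _).trans (Finset.erase_subset _ _)) h3
        fun y hy a ha => ?_
      rw [Finset.mem_singleton.1 hy]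
      exact (Finset.mem_filter.1 ha).2
    · refine hin {x} hXS hX hXc ((S.erase x).filter fun y => ¬ T.Adj x y)
        ((Finset.filter_subset _ _).trans (Finset.erase_subset _ _)) (by linarith)
        fun y hy a ha => ?_
      rw [Finset.mem_singleton.1 hy]
      obtain ⟨ha1, ha2⟩ := Finset.mem_filter.1 ha
      exact (T.not_adj_iff (Finset.ne_of_mem_erase ha1).symm).1 ha2
  have hs1 : 1 ≤ s := by
    by_contra! hlt
    have h1 := Real.rpow_le_one hspos.le hlt.le he.le
    rw [hst] at h1
    have h2 := mul_le_mul_of_nonneg_right hce htpos.le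
    nlinarith
  refine hH.not_critical hT hn hs1 ht12 (fun A hA hAc => ?_) hout hin ?_
  · obtain ⟨X, hX, hXt, hXc⟩ := hbig A hA hAc
    refine ⟨X, hX, hXt, le_trans ?_ hXc⟩
    nlinarith
  -- The factor `8` in `hc` uses up only half of `|S|`; the other half is at least `1`.
  · have h1 : (2 * pairLoss n) ^ (2 * n) * (4 * n * s) =
        c * (8 * n * (2 * pairLoss n) ^ (2 * n)) * S.card / 2 := by
      rw [hs]; ring
    have h2 := mul_le_mul_of_nonneg_right hc hSpos.le
    rw [h1]
    linarith

/-! ### The explicit exponent and the asymptotics. -/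

/-- The logarithm of the loss is of order `n ^ 2 * log n`; bounding `log n` by `n` wastes nearly one
power of `n`, which the final estimate can afford. -/
theorem loss_le_exp {n : ℕ} (hn : 0 < n) :
    8 * n * (2 * pairLoss n) ^ (2 * n) ≤ Real.exp (36 * n ^ 3) := by
  have hn1 : (1 : ℝ) ≤ n := by exact_mod_cast hn
  have hexp1 : (2 : ℝ) ≤ Real.exp 1 := by linarith [Real.exp_one_gt_d9]
  have hpow : ∀ k : ℕ, (2 : ℝ) ^ k ≤ Real.exp k := fun k => by
    rw [← Real.exp_one_pow]
    gcongr
  have hne : (n : ℝ) ≤ Real.exp n := by linarith [Real.add_one_le_exp (n : ℝ)]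
  have h8 : (8 : ℝ) ≤ Real.exp 3 := by
    have := hpow 3
    norm_num at this
    exact this
  have h192 : (192 : ℝ) ≤ Real.exp 8 := by
    have := hpow 8
    norm_num at this
    linarith
  have h1 : 2 / (1 / (96 * (n : ℝ) ^ 3)) ≤ Real.exp (8 + 3 * n) := by
    calc 2 / (1 / (96 * (n : ℝ) ^ 3)) = 192 * (n : ℝ) ^ 3 := by field_simp; norm_num
      _ ≤ Real.exp 8 * Real.exp n ^ 3 := by gcongr
      _ = _ := by rw [← Real.exp_nat_mul, ← Real.exp_add]; norm_num
  have h2 : 2 * pairLoss n ≤ Real.exp (14 * n ^ 2 + 2) := by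
    calc 2 * pairLoss n = 8 * (n : ℝ) ^ 2 * (2 / (1 / (96 * (n : ℝ) ^ 3))) ^ n := by
          rw [pairLoss]; ring
      _ ≤ Real.exp 3 * Real.exp n ^ 2 * Real.exp (8 + 3 * n) ^ n := by gcongr
      _ = Real.exp (3 + 2 * n + n * (8 + 3 * n)) := by
          rw [← Real.exp_nat_mul, ← Real.exp_nat_mul, ← Real.exp_add, ← Real.exp_add]
          norm_num
      _ ≤ _ := by
          apply Real.exp_le_exp.2
          nlinarith
  have h0 : 0 ≤ 2 * pairLoss n := by
    rw [pairLoss]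
    positivity
  calc 8 * n * (2 * pairLoss n) ^ (2 * n)
      ≤ Real.exp 3 * Real.exp n * Real.exp (14 * n ^ 2 + 2) ^ (2 * n) := by gcongr
    _ = Real.exp (3 + n + 2 * n * (14 * n ^ 2 + 2)) := by
        rw [← Real.exp_nat_mul, ← Real.exp_add, ← Real.exp_add]
        push_cast
        rfl
    _ ≤ _ := by
        apply Real.exp_le_exp.2
        have h3 : (n : ℝ) ≤ n ^ 3 := by nlinarith [mul_self_nonneg ((n : ℝ) - 1)]
        nlinarith

/-- A galaxy with `n` vertices has the Erdős–Hajnal exponent `1 / (432 n ^ 4)`. -/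
theorem IsGalaxy.mem_ehExponents {V : Type*} [Fintype V] [Nonempty V] {H : Tournament V}
    (hH : H.IsGalaxy) : 1 / (432 * (Fintype.card V : ℝ) ^ 4) ∈ H.ehExponents := by
  set n := Fintype.card V with hn
  have hn0 : 0 < n := Fintype.card_pos
  have hn1 : (1 : ℝ) ≤ n := by exact_mod_cast hn0
  have he : (0 : ℝ) < 1 / (432 * (n : ℝ) ^ 4) := by positivity
  refine ⟨he, fun W _ T hT => ?_⟩
  have hn3 : (1 : ℝ) ≤ (n : ℝ) ^ 3 := one_le_pow₀ hn1
  have h1 : Real.exp (-(36 * n ^ 3)) * (8 * n * (2 * pairLoss n) ^ (2 * n)) ≤ 1 := by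
    calc _ ≤ Real.exp (-(36 * n ^ 3)) * Real.exp (36 * n ^ 3) :=
          mul_le_mul_of_nonneg_left (loss_le_exp hn0) (Real.exp_pos _).le
      _ = 1 := by rw [← Real.exp_add, neg_add_cancel, Real.exp_zero]
  have h2 : Real.exp (-(36 * n ^ 3)) ≤ 1 / 4 := by
    rw [Real.exp_neg, inv_eq_one_div]
    apply one_div_le_one_div_of_le (by norm_num)
    linarith [Real.add_one_le_exp (36 * (n : ℝ) ^ 3)]
  -- With `c = exp (-36 n ^ 3)` and `432 = 36 * 12`, the power `c ^ e` equals `exp (-1 / (12n))`.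
  have h3 : 1 - 1 / (12 * n) ≤ Real.exp (-(36 * n ^ 3)) ^ (1 / (432 * (n : ℝ) ^ 4)) := by
    have : -(36 * (n : ℝ) ^ 3) * (1 / (432 * (n : ℝ) ^ 4)) = -(1 / (12 * n)) := by
      field_simp
      norm_num
    rw [← Real.exp_mul, this]
    linarith [Real.add_one_le_exp (-(1 / (12 * (n : ℝ))))]
  obtain ⟨X, -, hX, hXc⟩ :=
    hH.exists_isTransitiveSet hT hn (Real.exp_pos _) h1 h2 he h3 Finset.univ
  exact ⟨X, hX, by simpa using hXc⟩

end Tournament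

theorem theorem2 :
    ∃ f g : ℕ → ℝ, Tendsto f atTop (𝓝 0) ∧ Tendsto g atTop (𝓝 0) ∧
      ∀ (V : Type*) [Fintype V] (H : Tournament V), 3 ≤ Fintype.card V →
        H.IsPrime → H.IsGalaxy →
        0 < H.ehCoeff ∧
        -5 + f (Fintype.card V) ≤ Real.log H.ehCoeff / Real.log (Fintype.card V) ∧
        Real.log H.ehCoeff / Real.log (Fintype.card V) ≤ -1 + g (Fintype.card V) := by
  have hlog : Tendsto (fun n : ℕ => Real.log n) atTop atTop :=
    Real.tendsto_log_atTop.comp tendsto_natCast_atTop_atTop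
  -- These are the logarithms of the two bounds divided by `log n`. The lower one would even allow
  -- `-4` in place of `-5`.
  refine ⟨fun n => -Real.log 432 / Real.log n,
    fun n => Real.log 12 / Real.log n + Real.log (Real.log n) / Real.log n,
    hlog.const_div_atTop _, ?_, ?_⟩
  · have h : Tendsto (fun x : ℝ => Real.log x / x) atTop (𝓝 0) :=
      Real.isLittleO_log_id_atTop.tendsto_div_nhds_zero
    simpa using (hlog.const_div_atTop (Real.log 12)).add (h.comp hlog)
  · intro V _ H hV _ hH
    have hne : Nonempty V := Fintype.card_pos_iff.1 (by omega)
    have hmem := hH.mem_ehExponents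
    have hle := fun e => H.exponent_le (e := e) hV
    set n := Fintype.card V with hn
    have hn3 : (3 : ℝ) ≤ n := by exact_mod_cast hV
    have hlpos : 0 < Real.log n := Real.log_pos (by linarith)
    have hlow : 1 / (432 * (n : ℝ) ^ 4) ≤ H.ehCoeff :=
      le_csSup ⟨_, fun e he => hle e he⟩ hmem
    have hup : H.ehCoeff ≤ 12 * Real.log n / n := csSup_le ⟨_, hmem⟩ hle
    have hpos : 0 < H.ehCoeff := lt_of_lt_of_le (by positivity) hlow
    refine ⟨hpos, ?_, ?_⟩
    · rw [le_div_iff₀ hlpos, add_mul, div_mul_cancel₀ _ hlpos.ne']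
      have h1 := Real.log_le_log (by positivity) hlow
      rw [one_div, Real.log_inv, Real.log_mul (by norm_num) (by positivity), Real.log_pow] at h1
      push_cast at h1
      linarith
    · rw [div_le_iff₀ hlpos, add_mul, add_mul, div_mul_cancel₀ _ hlpos.ne',
        div_mul_cancel₀ _ hlpos.ne']
      have h1 := Real.log_le_log hpos hup
      rw [Real.log_div (by positivity) (by positivity),
        Real.log_mul (by norm_num) hlpos.ne'] at h1
      linarith
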